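/- **Setting.** Let $N\ge 2$, and let $L\subset\mathbb Z$ be an interval of integers containing $0$: $L=\mathbb Z$, $L=\{\ell\ge L_-\}$, $L=\{\ell\le L_+\}$ or $L=\{L_-,\dots,L_+\}$ with $L_-\le 0\le L_+$. Let $\{\Omega_\ell\}_{\ell\in L}$ be pairwise disjoint open subsets of $\mathbb R^N$ with $\bigcup_{\ell\in L}\overline{\Omega_\ell}=\mathbb R^N$, such that every ball $B_R=\{|x|<R\}$ meets only finitely many $\Omega_\ell$. For each $\ell\in L$ let $\partial\Omega_\ell=S_\ell^{(-)}\cup S_\ell^{(+)}$ be a disjoint union, with $S_\ell^{(+)}=S_{\ell+1}^{(-)}$ if $\ell,\ell+1\in L$, $S_\ell^{(+)}=\emptyset$ if $\ell+1\notin L$, and $S_\ell^{(-)}=\emptyset$ if $\ell-1\notin L$. These surfaces are piecewise smooth in the following sense: up to a set of zero $(N-1)$-dimensional Hausdorff measure, near each point $x\in\partial\Omega_\ell$ the boundary $\partial\Omega_\ell$ is a $C^1$ hypersurface with $\Omega_\ell$ lying on exactly one side of it; at such $x$ let $n^{(\ell)}(x)$ be the unit outward normal of $\Omega_\ell$. Let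 $\mu_0$ be a positive function on $\mathbb R^N$ with $\mu_0=\nu_\ell$ on $\Omega_\ell$, where $0<\inf_{\ell\in L}\nu_\ell\le\sup_{\ell\in L}\nu_\ell<\infty$, and assume that $$(\nu_\ell-\nu_{\ell+1})\,\bigl(n^{(\ell)}(x)\cdot x\bigr)\le 0$$ for all $\ell$ with $\ell,\ell+1\in L$ and all $x\in S_\ell^{(+)}$ at which $n^{(\ell)}(x)$ is defined. Let $\mu=\mu_0+\mu_1$ be a real measurable function on $\mathbb R^N$ with $0<\inf\mu\le\sup\mu<\infty$, and let $H$ be the operator in the complex Hilbert space $X=L^2(\mathbb R^N;\mu(x)\,dx)$ with domain $D(H)=H^2(\mathbb R^N)$ and $Hu=-\mu(x)^{-1}\Delta u$, where $\Delta u$ is taken in the sense of distributions. Let $\sigma_p(H)$ be the set of all eigenvalues of $H$. **Theorem 4.8.** (i) If $\lambda_0>0$, $\mu_1$ is measurable and $\mu(x)\ge N\mu_1(x)+\lambda_0\bigl(|x|\,|\mu_1(x)|\bigr)^2$ for almost every $x\in\mathbb R^N$, then $\sigma_p(H)\cap[0,\lambda_0]=\emptyset$. (ii) If $\mu_1$ is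 differentiable on $\mathbb R^N$ and $\mu(x)+|x|\,\dfrac{\partial\mu_1}{\partial|x|}(x)\ge 0$ for almost every $x\in\mathbb R^N$, then $\sigma_p(H)=\emptyset$. -/

import Mathlib

open MeasureTheory
open scoped ENNReal SchwartzMap Laplacian

noncomputable section

/-! ### Layered media -/

/-- The admissible index sets of layers: all intervals of integers, bounded or unbounded on
either side, that contain `0`. -/
def IsLayerIndexSet (L : Set ℤ) : Prop :=
  L = Set.univ ∨
  (∃ a : ℤ, a ≤ 0 ∧ L = Set.Ici a) ∨
  (∃ b : ℤ, 0 ≤ b ∧ L = Set.Iic b) ∨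
  (∃ a b : ℤ, a ≤ 0 ∧ 0 ≤ b ∧ L = Set.Icc a b)

/-- `n` is the unit outward normal of the open set `Ω` at its boundary point `x`: near `x` the
boundary of `Ω` is a `C¹` hypersurface `{φ = 0}`, with `Ω = {φ < 0}` lying on exactly one side
of it, and `n` is the unit vector in the direction of the (nonzero) gradient of `φ` at `x`. -/
def IsUnitOutwardNormal {N : ℕ} (Ω : Set (EuclideanSpace ℝ (Fin N)))
    (x n : EuclideanSpace ℝ (Fin N)) : Prop :=
  ‖n‖ = 1 ∧
  ∃ (φ : EuclideanSpace ℝ (Fin N) → ℝ) (c : ℝ),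
    0 < c ∧ ContDiffAt ℝ 1 φ x ∧ φ x = 0 ∧ HasGradientAt φ (c • n) x ∧
    ∀ᶠ y in nhds x, (y ∈ Ω ↔ φ y < 0)

/-- A layered medium in `ℝ^N`: a locally finite family of disjoint open layers `Ω ℓ`, `ℓ ∈ L`,
whose closures cover `ℝ^N`, with separating surfaces `Sm ℓ = S_ℓ^(-)` and `Sp ℓ = S_ℓ^(+)`, and a
positive function `μ₀` equal to the constant `ν ℓ` on the layer `Ω ℓ`. Only the values of `Ω`,
`Sm`, `Sp`, `ν` at indices in `L` matter, and `μ₀` is an arbitrary positive function on the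
separating surfaces.

The regularity required of the surfaces is that the boundary of every layer is smooth of class
`C¹`, with an outward normal, at all of its points except for a set of vanishing
`(N-1)`-dimensional Hausdorff measure (edges, corners, vertices of cones, ...). -/
structure IsLayeredMedium {N : ℕ} (L : Set ℤ)
    (Ω Sm Sp : ℤ → Set (EuclideanSpace ℝ (Fin N))) (ν : ℤ → ℝ)
    (μ₀ : EuclideanSpace ℝ (Fin N) → ℝ) : Prop where
  index : IsLayerIndexSet L
  isOpen : ∀ ℓ ∈ L, IsOpen (Ω ℓ)
  disjoint : ∀ ℓ ∈ L, ∀ k ∈ L, ℓ ≠ k → Disjoint (Ω ℓ) (Ω k)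
  cover : ⋃ ℓ ∈ L, closure (Ω ℓ) = Set.univ
  locally_finite : ∀ R : ℝ, 0 < R →
    {ℓ | ℓ ∈ L ∧ (Ω ℓ ∩ Metric.ball 0 R).Nonempty}.Finite
  frontier_eq : ∀ ℓ ∈ L, frontier (Ω ℓ) = Sm ℓ ∪ Sp ℓ
  surfaces_disjoint : ∀ ℓ ∈ L, Disjoint (Sm ℓ) (Sp ℓ)
  surface_eq : ∀ ℓ ∈ L, ℓ + 1 ∈ L → Sp ℓ = Sm (ℓ + 1)
  surface_first : ∀ ℓ ∈ L, ℓ - 1 ∉ L → Sm ℓ = ∅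
  surface_last : ∀ ℓ ∈ L, ℓ + 1 ∉ L → Sp ℓ = ∅
  smooth_ae : ∀ ℓ ∈ L,
    Measure.hausdorffMeasure ((N : ℝ) - 1)
      {x | x ∈ frontier (Ω ℓ) ∧ ¬ ∃ n, IsUnitOutwardNormal (Ω ℓ) x n} = 0
  pos : ∀ x, 0 < μ₀ x
  value : ∀ ℓ ∈ L, ∀ x ∈ Ω ℓ, μ₀ x = ν ℓ
  bounds : ∃ m M : ℝ, 0 < m ∧ ∀ ℓ ∈ L, m ≤ ν ℓ ∧ ν ℓ ≤ M
  monotone : ∀ ℓ ∈ L, ℓ + 1 ∈ L → ∀ x ∈ Sp ℓ, ∀ n, IsUnitOutwardNormal (Ω ℓ) x n →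
    (ν ℓ - ν (ℓ + 1)) * inner ℝ n x ≤ 0

/-! ### The reduced wave operator -/

/-- Measurable coefficients bounded above and below by positive constants. -/
structure IsAdmissibleWeight {N : ℕ} (μ : EuclideanSpace ℝ (Fin N) → ℝ) : Prop where
  aemeasurable : AEMeasurable μ volume
  bounds : ∃ m M : ℝ, 0 < m ∧ ∀ x, m ≤ μ x ∧ μ x ≤ M

/-- The measure `μ(x) dx`. -/
def weightMeasure {N : ℕ} (μ : EuclideanSpace ℝ (Fin N) → ℝ) :
    Measure (EuclideanSpace ℝ (Fin N)) :=
  volume.withDensity fun x => ENNReal.ofReal (μ x)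

/-- The Hilbert space `X = L²(ℝ^N; μ(x) dx)` of complex-valued functions. -/
abbrev WeightedL2 {N : ℕ} (μ : EuclideanSpace ℝ (Fin N) → ℝ) : Type :=
  Lp ℂ 2 (weightMeasure μ)

namespace IsAdmissibleWeight

variable {N : ℕ} {μ : EuclideanSpace ℝ (Fin N) → ℝ}

theorem absolutelyContinuous (_hμ : IsAdmissibleWeight μ) :
    weightMeasure μ ≪ (volume : Measure (EuclideanSpace ℝ (Fin N))) :=
  withDensity_absolutelyContinuous _ _

theorem absolutelyContinuous' (hμ : IsAdmissibleWeight μ) :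
    (volume : Measure (EuclideanSpace ℝ (Fin N))) ≪ weightMeasure μ := by
  obtain ⟨m, M, hm, h⟩ := hμ.bounds
  refine withDensity_absolutelyContinuous' hμ.aemeasurable.ennreal_ofReal ?_
  refine Filter.Eventually.of_forall fun x => ?_
  have := (h x).1
  simp only [ne_eq, ENNReal.ofReal_eq_zero, not_le]
  linarith

theorem memLp_iff (hμ : IsAdmissibleWeight μ) {f : EuclideanSpace ℝ (Fin N) → ℂ} :
    MemLp f 2 (weightMeasure μ) ↔ MemLp f 2 volume := by
  obtain ⟨m, M, hm, h⟩ := hμ.bounds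
  constructor
  · intro hf
    have hle : (volume : Measure (EuclideanSpace ℝ (Fin N)))
        ≤ (ENNReal.ofReal m)⁻¹ • weightMeasure μ := by
      have h1 : ENNReal.ofReal m • (volume : Measure (EuclideanSpace ℝ (Fin N)))
          ≤ weightMeasure μ := by
        rw [← withDensity_const]
        exact withDensity_mono (Filter.Eventually.of_forall fun x =>
          ENNReal.ofReal_le_ofReal (h x).1)
      have hm0 : ENNReal.ofReal m ≠ 0 := by simpa using hm
      calc (volume : Measure (EuclideanSpace ℝ (Fin N)))
          = (ENNReal.ofReal m)⁻¹ • (ENNReal.ofReal m • volume) := by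
            rw [smul_smul, ENNReal.inv_mul_cancel hm0 ENNReal.ofReal_ne_top, one_smul]
        _ ≤ _ := by gcongr
    refine hf.of_measure_le_smul ?_ hle
    simpa using hm
  · intro hf
    have hle : weightMeasure μ
        ≤ ENNReal.ofReal M • (volume : Measure (EuclideanSpace ℝ (Fin N))) := by
      rw [← withDensity_const]
      exact withDensity_mono (Filter.Eventually.of_forall fun x =>
        ENNReal.ofReal_le_ofReal (h x).2)
    exact hf.of_measure_le_smul ENNReal.ofReal_ne_top hle

/-- The identification of `X` with `L²(ℝ^N)`: the same functions with an equivalent norm. -/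
def toL2 (hμ : IsAdmissibleWeight μ) :
    WeightedL2 μ →ₗ[ℂ] Lp ℂ 2 (volume : Measure (EuclideanSpace ℝ (Fin N))) where
  toFun u := (hμ.memLp_iff.1 (Lp.memLp u)).toLp u
  map_add' u v := by
    rw [← MemLp.toLp_add]
    exact MemLp.toLp_congr _ _ (hμ.absolutelyContinuous'.ae_le (Lp.coeFn_add u v))
  map_smul' c u := by
    rw [RingHom.id_apply, ← MemLp.toLp_const_smul]
    exact MemLp.toLp_congr _ _ (hμ.absolutelyContinuous'.ae_le (Lp.coeFn_smul c u))

theorem memLp_neg_inv_mul (hμ : IsAdmissibleWeight μ)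
    (w : Lp ℂ 2 (volume : Measure (EuclideanSpace ℝ (Fin N)))) :
    MemLp (fun x => -((μ x : ℂ)⁻¹ * w x)) 2 (weightMeasure μ) := by
  rw [hμ.memLp_iff]
  obtain ⟨m, M, hm, h⟩ := hμ.bounds
  refine MemLp.neg (MemLp.of_le_mul (c := m⁻¹) (Lp.memLp w) ?_ ?_)
  · exact ((Complex.measurable_ofReal.comp_aemeasurable
      hμ.aemeasurable).inv.aestronglyMeasurable).mul (Lp.aestronglyMeasurable w)
  · refine Filter.Eventually.of_forall fun x => ?_
    have hx := (h x).1
    have hpos : 0 < μ x := by linarith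
    rw [norm_mul, norm_inv, Complex.norm_real, Real.norm_of_nonneg hpos.le]
    gcongr

/-- Multiplication by `-1/μ(x)`, from `L²(ℝ^N)` to `X`. -/
def negInvMul (hμ : IsAdmissibleWeight μ) :
    Lp ℂ 2 (volume : Measure (EuclideanSpace ℝ (Fin N))) →ₗ[ℂ] WeightedL2 μ where
  toFun w := (hμ.memLp_neg_inv_mul w).toLp _
  map_add' v w := by
    rw [← MemLp.toLp_add]
    refine MemLp.toLp_congr _ _ ?_
    filter_upwards [hμ.absolutelyContinuous.ae_le (Lp.coeFn_add v w)] with x hx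
    simp only [hx, Pi.add_apply]
    ring
  map_smul' c w := by
    rw [RingHom.id_apply, ← MemLp.toLp_const_smul]
    refine MemLp.toLp_congr _ _ ?_
    filter_upwards [hμ.absolutelyContinuous.ae_le (Lp.coeFn_smul c w)] with x hx
    simp only [hx, Pi.smul_apply, smul_eq_mul]
    ring

end IsAdmissibleWeight

/-- The Sobolev space `H²(ℝ^N)`, as a subspace of `L²(ℝ^N)`. -/
def sobolevH2 (N : ℕ) :
    Submodule ℂ (Lp ℂ 2 (volume : Measure (EuclideanSpace ℝ (Fin N)))) where
  carrier := {u | TemperedDistribution.MemSobolev 2 2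
    (u : 𝓢'(EuclideanSpace ℝ (Fin N), ℂ))}
  add_mem' {u v} hu hv := by
    have := TemperedDistribution.MemSobolev.add hu hv
    rwa [← Lp.toTemperedDistributionCLM_apply, ← Lp.toTemperedDistributionCLM_apply,
      ← map_add] at this
  zero_mem' := by
    have := TemperedDistribution.memSobolev_fun_zero (EuclideanSpace ℝ (Fin N)) ℂ 2 2
    rwa [← map_zero (Lp.toTemperedDistributionCLM ℂ
      (volume : Measure (EuclideanSpace ℝ (Fin N))) 2)] at this
  smul_mem' c u hu := by
    have := TemperedDistribution.MemSobolev.smul c hu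
    rwa [← Lp.toTemperedDistributionCLM_apply, ← map_smul] at this

theorem exists_laplacian_eq {N : ℕ} (u : sobolevH2 N) :
    ∃ w : Lp ℂ 2 (volume : Measure (EuclideanSpace ℝ (Fin N))),
      Δ ((u : Lp ℂ 2 (volume : Measure (EuclideanSpace ℝ (Fin N)))) :
        𝓢'(EuclideanSpace ℝ (Fin N), ℂ)) = (w : 𝓢'(EuclideanSpace ℝ (Fin N), ℂ)) := by
  have h : TemperedDistribution.MemSobolev 2 2
    ((u : Lp ℂ 2 (volume : Measure (EuclideanSpace ℝ (Fin N)))) :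
        𝓢'(EuclideanSpace ℝ (Fin N), ℂ)) := u.2
  have h2 := h.laplacian
  rw [sub_self] at h2
  exact TemperedDistribution.memSobolev_zero_iff.1 h2

theorem toTemperedDistribution_injective_L2 {N : ℕ} :
    Function.Injective (Lp.toTemperedDistributionCLM ℂ
      (volume : Measure (EuclideanSpace ℝ (Fin N))) 2) :=
  LinearMap.ker_eq_bot.1 Lp.ker_toTemperedDistributionCLM_eq_bot

/-- The Laplacian `H²(ℝ^N) → L²(ℝ^N)`, in the sense of distributions. -/
def laplacianH2 (N : ℕ) :
    sobolevH2 N →ₗ[ℂ] Lp ℂ 2 (volume : Measure (EuclideanSpace ℝ (Fin N))) where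
  toFun u := (exists_laplacian_eq u).choose
  map_add' u v := by
    apply toTemperedDistribution_injective_L2
    rw [map_add]
    simp only [Lp.toTemperedDistributionCLM_apply]
    rw [← (exists_laplacian_eq (u + v)).choose_spec, ← (exists_laplacian_eq u).choose_spec,
      ← (exists_laplacian_eq v).choose_spec]
    simp only [← TemperedDistribution.laplacianCLM_apply, ← Lp.toTemperedDistributionCLM_apply,
      ← map_add, Submodule.coe_add]
  map_smul' c u := by
    apply toTemperedDistribution_injective_L2
    rw [map_smul]
    simp only [Lp.toTemperedDistributionCLM_apply]
    rw [← (exists_laplacian_eq (c • u)).choose_spec, ← (exists_laplacian_eq u).choose_spec]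
    simp only [← TemperedDistribution.laplacianCLM_apply, ← Lp.toTemperedDistributionCLM_apply,
      ← map_smul, Submodule.coe_smul, RingHom.id_apply]

/-- The reduced wave operator `H u = -μ(x)⁻¹ Δ u` in `X = L²(ℝ^N; μ(x) dx)`, with domain
`H²(ℝ^N)`. -/
def reducedWaveOperator {N : ℕ} {μ : EuclideanSpace ℝ (Fin N) → ℝ}
    (hμ : IsAdmissibleWeight μ) : WeightedL2 μ →ₗ.[ℂ] WeightedL2 μ where
  domain := (sobolevH2 N).comap hμ.toL2
  toFun := hμ.negInvMul ∘ₗ laplacianH2 N ∘ₗ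
    hμ.toL2.restrict (p := (sobolevH2 N).comap hμ.toL2) (q := sobolevH2 N) fun _ hu => hu

/-- The point spectrum `σ_p(T)`: the set of all (complex) eigenvalues of an operator `T`. -/
def pointSpectrum {X : Type*} [AddCommGroup X] [Module ℂ X] (T : X →ₗ.[ℂ] X) : Set ℂ :=
  {z | ∃ u : T.domain, (u : X) ≠ 0 ∧ T u = z • (u : X)}

end

/-!
Why the theorem holds. Let `Δu = -lam μ u` with `u ∈ H²`. Green's formula gives `lam ∈ ℝ` and
`∫ |∇u|² = lam ∫ μ |u|²`, so only `lam ≥ 0` matters, and `lam = 0` means `∇u = 0`. For `lam > 0`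
the virial identity for the vector field `x` reads, formally,
`2 ∫ μ Re (ū x·∇u) = -(N - 2) ∫ μ |u|²`
(`IsCutoffSequence.tendsto_eigenfunction`). The left side is bounded by monotonicity along rays.
If `r ↦ r ^ α m (r x)` is nondecreasing for almost every `x`, then `x·∇m + α m` is a nonnegative
distribution, whence
`(N - α) ∫ m |u|² + 2 ∫ m Re (ū x·∇u) ≤ 0` (`IsCutoffSequence.monotone_weight_limit`).

* For (ii) this applies to `m = μ` with `α = 1`, and the two relations give `∫ μ |u|² ≤ 0`
  (`HasGradientLaplacian.eq_zero_of_monotone_mul`).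
* For (i) it applies to `m = μ₀` with `α = 0`. Completing the square turns the result into
  `∫ |∇u - lam μ₁ x u|² + lam ∫ (μ - N μ₁ - lam |x|² μ₁²) |u|² ≤ 0`. Both terms are nonnegative, so
  both vanish; as the second factor is allowed to be zero, this is not yet `u = 0`
  (`HasGradientLaplacian.eq_zero_of_monotone`). The resulting equations `∇u = lam μ₁ x u` and
  `μ |u|² = (N μ₁ + lam |x|² μ₁²) |u|²`, combined with Green's formula for a suitable multiplier,
  imply `∫ (div w) |u|² = 0` for a field `w` with `div w > 0` away from the origin
  (`HasGradientLaplacian.eq_zero_of_gradient_eq`).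

Monotonicity along rays is where the geometry enters. Almost every ray from the origin meets the
separating surfaces only at smooth points, since the cone over a set of vanishing
`(N - 1)`-dimensional measure is a null set, and only transversally, by Sard's lemma
(`IsLayeredMedium.ae_isTransversalRay`). At each crossing the ray passes between neighbouring
layers, and the sign condition says that `ν` does not decrease. A supremum argument then gives
monotonicity along the whole ray (`IsLayeredMedium.IsTransversalRay.le_of_mem`).

The integral identities are proved for Schwartz functions by integration by parts and extended to
`H²` by approximation (`exists_schwartz_approximation`); the unbounded field `x` is reached through
cutoff functions.
-/

open Set Filter Topology
open scoped LineDeriv FourierTransform Real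

/-! ### Monotonicity on an interval from local information -/

/-- A function of a real variable which near every point lies below its value on the left and
above it on the right is monotone; jumps are allowed. -/
theorem le_of_forall_eventually_le {f : ℝ → ℝ} {a b : ℝ} (hab : a ≤ b)
    (hr : ∀ t ∈ Ico a b, ∀ᶠ s in 𝓝[>] t, f t ≤ f s)
    (hl : ∀ t ∈ Ioc a b, ∀ᶠ s in 𝓝[<] t, f s ≤ f t) : f a ≤ f b := by
  set S : Set ℝ := {s | s ∈ Icc a b ∧ ∀ r ∈ Icc a s, f a ≤ f r} with hS
  have haS : a ∈ S := ⟨⟨le_rfl, hab⟩, fun r hr => by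
    rw [le_antisymm hr.2 hr.1]⟩
  have hbd : BddAbove S := ⟨b, fun s hs => hs.1.2⟩
  set c := sSup S with hc
  have hac : a ≤ c := le_csSup hbd haS
  have hcb : c ≤ b := csSup_le ⟨a, haS⟩ fun s hs => hs.1.2
  have hlt : ∀ r, a ≤ r → r < c → f a ≤ f r := by
    intro r har hrc
    obtain ⟨s, hs, hrs⟩ := exists_lt_of_lt_csSup ⟨a, haS⟩ hrc
    exact hs.2 r ⟨har, hrs.le⟩
  have hfc : f a ≤ f c := by
    rcases hac.eq_or_lt with h | h
    · rw [← h]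
    · have h1 := hl c ⟨h, hcb⟩
      have h2 : ∀ᶠ s in 𝓝[<] c, s ∈ Ioo a c := Ioo_mem_nhdsLT h
      obtain ⟨s, hs1, hs2⟩ := (h1.and h2).exists
      exact (hlt s hs2.1.le hs2.2).trans hs1
  rcases hcb.eq_or_lt with h | h
  · rwa [← h]
  · -- if `c < b`, then the inequality persists beyond the supremum `c`
    exfalso
    have h1 := hr c ⟨hac, h⟩
    have h1' : ∀ᶠ s in 𝓝[>] c, s ∈ Ioo c b := Ioo_mem_nhdsGT h
    obtain ⟨d, hd, hd'⟩ := (mem_nhdsGT_iff_exists_Ioo_subset).1 (h1.and h1')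
    have hd0 : c < d := hd
    have hmem : (c + d) / 2 ∈ S := by
      refine ⟨⟨by linarith, ?_⟩, fun r hr => ?_⟩
      · exact (hd' ⟨by linarith, by linarith⟩ : _ ∧ _).2.2.le
      · rcases lt_trichotomy r c with h3 | h3 | h3
        · exact hlt r hr.1 h3
        · rw [h3]; exact hfc
        · exact hfc.trans (hd' ⟨h3, by linarith [hr.2]⟩ : _ ∧ _).1
    have := le_csSup hbd hmem
    linarith

/-- A function which is differentiable everywhere, with a derivative that is nonnegative almost
everywhere, is monotone. The derivative need not be integrable. -/
theorem le_of_hasDerivAt_of_ae_nonneg {f f' : ℝ → ℝ} {a b : ℝ} (hab : a ≤ b)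
    (hf : ∀ t ∈ Icc a b, HasDerivAt f (f' t) t)
    (h0 : ∀ᵐ t, t ∈ Ioo a b → 0 ≤ f' t) : f a ≤ f b := by
  -- `min f' 0` is an integrable lower bound of the derivative with integral zero
  have hae : (fun t => min (f' t) 0) =ᵐ[volume.restrict (Icc a b)] fun _ => (0 : ℝ) := by
    rw [← restrict_Ioo_eq_restrict_Icc]
    filter_upwards [(ae_restrict_iff' measurableSet_Ioo).2 h0] with t ht
    exact min_eq_right ht
  have hint : IntegrableOn (fun t => min (f' t) 0) (Icc a b) :=
    (integrable_zero ℝ ℝ _).congr hae.symm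
  have h := intervalIntegral.integral_le_sub_of_hasDeriv_right_of_le hab
    (fun t ht => (hf t ht).continuousAt.continuousWithinAt)
    (fun t ht => (hf t (Ioo_subset_Icc_self ht)).hasDerivWithinAt) hint
    (fun t _ => min_le_left _ _)
  have hz : ∫ y in a..b, min (f' y) 0 = 0 := by
    rw [intervalIntegral.integral_of_le hab, ← integral_Icc_eq_integral_Ioc,
      integral_congr_ae hae, integral_zero]
  linarith

/-! ### Null sets and rays -/

section Rays

variable {E : Type*} [NormedAddCommGroup E] [InnerProductSpace ℝ E] [FiniteDimensional ℝ E]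
  [MeasurableSpace E] [BorelSpace E]

theorem volume_preimage_smul_eq_zero {t : ℝ} (ht : t ≠ 0) {Z : Set E} :
    volume ((fun x : E => t • x) ⁻¹' Z) = 0 ↔ volume Z = 0 := by
  rw [Measure.addHaar_preimage_smul _ ht]
  simp [ht]

theorem ae_smul_of_ae {P : E → Prop} (h : ∀ᵐ y, P y) {t : ℝ} (ht : t ≠ 0) :
    ∀ᵐ x, P (t • x) := by
  rw [ae_iff] at h ⊢
  exact (volume_preimage_smul_eq_zero ht).2 h

/-- Fubini's theorem for the map `(x, t) ↦ t • x`: null sets on almost every ray correspond to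
null dilates for almost every dilation factor. -/
theorem volume_ray_swap {Z : Set E} (hZ : MeasurableSet Z) :
    (∀ᵐ x, ∀ᵐ t ∂(volume.restrict (Ioi (0 : ℝ))), t • x ∉ Z) ↔
      ∀ᵐ t ∂(volume.restrict (Ioi (0 : ℝ))), ∀ᵐ x, t • x ∉ Z := by
  have hm : MeasurableSet {p : E × ℝ | p.2 • p.1 ∉ Z} :=
    ((measurable_snd.smul measurable_fst) hZ).compl
  have h1 := Measure.ae_ae_comm (μ := (volume : Measure E))
    (ν := volume.restrict (Ioi (0 : ℝ))) (p := fun x t => t • x ∉ Z) hm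
  exact h1

/-- A property that holds almost everywhere holds almost everywhere on almost every ray. -/
theorem ae_ae_smul_of_ae {P : E → Prop} (h : ∀ᵐ y, P y) :
    ∀ᵐ x : E, ∀ᵐ t ∂(volume.restrict (Ioi (0 : ℝ))), P (t • x) := by
  obtain ⟨Z, hZ, hZm, hZ0⟩ := exists_measurable_superset_of_null (ae_iff.1 h)
  have h2 : ∀ᵐ x : E, ∀ᵐ t ∂(volume.restrict (Ioi (0 : ℝ))), t • x ∉ Z := by
    rw [volume_ray_swap hZm]
    filter_upwards [ae_restrict_mem measurableSet_Ioi] with t ht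
    exact ae_smul_of_ae (P := fun y => y ∉ Z) (measure_eq_zero_iff_ae_notMem.1 hZ0) (ne_of_gt ht)
  filter_upwards [h2] with x hx
  filter_upwards [hx] with t ht
  by_contra hcon
  exact ht (hZ hcon)

/-- A measurable set which meets almost every ray in a null set is a null set. -/
theorem ae_notMem_of_ae_ae_smul {Z : Set E} (hZ : MeasurableSet Z)
    (h : ∀ᵐ x : E, ∀ᵐ t ∂(volume.restrict (Ioi (0 : ℝ))), t • x ∉ Z) : ∀ᵐ x : E, x ∉ Z := by
  rw [volume_ray_swap hZ] at h
  have hne : (volume.restrict (Ioi (0 : ℝ))) ≠ 0 := by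
    rw [Ne, Measure.restrict_eq_zero]; simp
  have : (ae (volume.restrict (Ioi (0 : ℝ)))).NeBot := ae_neBot.2 hne
  obtain ⟨t, ht, ht0⟩ := (h.and (ae_restrict_mem measurableSet_Ioi)).exists
  have ht' : volume ((fun x : E => t • x) ⁻¹' Z) = 0 := measure_eq_zero_iff_ae_notMem.2 ht
  exact measure_eq_zero_iff_ae_notMem.1
    ((volume_preimage_smul_eq_zero (ne_of_gt ht0)).1 ht')

/-- The union of the open rays from the origin that meet `A`. -/
def coneOver (A : Set E) : Set E := {y | ∃ t : ℝ, 0 < t ∧ t • y ∈ A}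

/-- The volume of the cone over a set, as an outer measure. Local and covering arguments for cones
thus become statements about outer measures. -/
noncomputable def coneOuterMeasure (E : Type*) [NormedAddCommGroup E] [InnerProductSpace ℝ E]
    [FiniteDimensional ℝ E] [MeasurableSpace E] [BorelSpace E] : OuterMeasure E where
  measureOf A := volume (coneOver A)
  empty := by simp [coneOver]
  mono {A B} h := measure_mono fun y ⟨t, ht, hy⟩ => ⟨t, ht, h hy⟩
  iUnion_nat s _ := by
    refine (measure_mono ?_).trans (measure_iUnion_le _)
    rintro y ⟨t, ht, hy⟩
    obtain ⟨i, hi⟩ := mem_iUnion.1 hy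
    exact mem_iUnion.2 ⟨i, t, ht, hi⟩

theorem coneOuterMeasure_apply (A : Set E) :
    coneOuterMeasure E A = volume (coneOver A) := rfl

/-- The outer measure `A ↦ |{s • a : a ∈ A, ‖a‖ ≤ R, 0 ≤ s ≤ R}|` of a truncated cone. -/
noncomputable def truncatedConeOuterMeasure (E : Type*) [NormedAddCommGroup E]
    [InnerProductSpace ℝ E] [FiniteDimensional ℝ E] [MeasurableSpace E] [BorelSpace E] (R : ℝ) :
    OuterMeasure E where
  measureOf A := volume {y : E | ∃ s ∈ Icc 0 R, ∃ a ∈ A, ‖a‖ ≤ R ∧ y = s • a}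
  empty := by simp
  mono {A B} h := measure_mono fun y ⟨s, hs, a, ha, h2⟩ => ⟨s, hs, a, h ha, h2⟩
  iUnion_nat S _ := by
    refine (measure_mono ?_).trans (measure_iUnion_le _)
    rintro y ⟨s, hs, a, ha, h2⟩
    obtain ⟨i, hi⟩ := mem_iUnion.1 ha
    exact mem_iUnion.2 ⟨i, s, hs, a, hi, h2⟩

/-- A truncated cone over a set of small diameter is a thin tube: it is covered by about `1 / d`
balls of radius comparable to `d`. -/
theorem truncatedConeOuterMeasure_le {R d : ℝ} (hR : 1 ≤ R) (hd : 0 < d) (hd1 : d ≤ 1) {A : Set E}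
    (hA : ∀ x ∈ A, ∀ y ∈ A, dist x y ≤ d) :
    truncatedConeOuterMeasure E R A ≤
      ENNReal.ofReal (2 * R * (2 * R) ^ Module.finrank ℝ E) * volume (Metric.ball (0 : E) 1) *
        ENNReal.ofReal (d ^ ((Module.finrank ℝ E : ℝ) - 1)) := by
  by_cases hne : ∃ a₀ ∈ A, ‖a₀‖ ≤ R
  swap
  · have : {y : E | ∃ s ∈ Icc 0 R, ∃ a ∈ A, ‖a‖ ≤ R ∧ y = s • a} = ∅ := by
      ext y
      simp only [mem_ofPred_eq, mem_empty_iff_false, iff_false]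
      rintro ⟨s, hs, a, ha, h1, -⟩
      exact hne ⟨a, ha, h1⟩
    change volume {y : E | ∃ s ∈ Icc 0 R, ∃ a ∈ A, ‖a‖ ≤ R ∧ y = s • a} ≤ _
    rw [this]; simp
  obtain ⟨a₀, ha₀, ha₀R⟩ := hne
  set n := ⌊R / d⌋₊ + 1 with hn
  have hsub : {y : E | ∃ s ∈ Icc 0 R, ∃ a ∈ A, ‖a‖ ≤ R ∧ y = s • a} ⊆
      ⋃ k ∈ Finset.range n, Metric.closedBall (((k : ℝ) * d) • a₀) (2 * R * d) := by
    rintro y ⟨s, hs, a, ha, haR, rfl⟩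
    have hk1 : (⌊s / d⌋₊ : ℝ) ≤ s / d := Nat.floor_le (div_nonneg hs.1 hd.le)
    have hk2 : s / d < ⌊s / d⌋₊ + 1 := Nat.lt_floor_add_one _
    rw [le_div_iff₀ hd] at hk1
    rw [div_lt_iff₀ hd] at hk2
    refine mem_iUnion₂.2 ⟨⌊s / d⌋₊, ?_, ?_⟩
    · rw [Finset.mem_range, hn, Nat.lt_succ_iff]
      exact Nat.floor_le_floor (by gcongr; exact hs.2)
    · rw [Metric.mem_closedBall, dist_eq_norm]
      have e : s • a - ((⌊s / d⌋₊ : ℝ) * d) • a₀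
          = s • (a - a₀) + (s - ⌊s / d⌋₊ * d) • a₀ := by
        rw [smul_sub, sub_smul]; abel
      rw [e]
      refine (norm_add_le _ _).trans ?_
      rw [norm_smul, norm_smul, Real.norm_of_nonneg hs.1, Real.norm_of_nonneg (by linarith)]
      have h1 : ‖a - a₀‖ ≤ d := by rw [← dist_eq_norm]; exact hA a ha a₀ ha₀
      have h2 : s * ‖a - a₀‖ ≤ R * d :=
        mul_le_mul hs.2 h1 (norm_nonneg _) (by linarith)
      have h3 : (s - ⌊s / d⌋₊ * d) * ‖a₀‖ ≤ d * R :=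
        mul_le_mul (by linarith) ha₀R (norm_nonneg _) hd.le
      linarith
  calc truncatedConeOuterMeasure E R A
      ≤ volume (⋃ k ∈ Finset.range n, Metric.closedBall (((k : ℝ) * d) • a₀) (2 * R * d)) :=
        measure_mono hsub
    _ ≤ ∑ k ∈ Finset.range n, volume (Metric.closedBall (((k : ℝ) * d) • a₀) (2 * R * d)) :=
        measure_biUnion_finset_le _ _
    _ = (n : ℝ≥0∞) * (ENNReal.ofReal ((2 * R * d) ^ Module.finrank ℝ E) *
          volume (Metric.ball (0 : E) 1)) := by
        have h1 : ∀ k ∈ Finset.range n, volume (Metric.closedBall (((k : ℝ) * d) • a₀)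
            (2 * R * d)) = ENNReal.ofReal ((2 * R * d) ^ Module.finrank ℝ E) *
              volume (Metric.ball (0 : E) 1) := fun k _ =>
          Measure.addHaar_closedBall volume _ (by positivity)
        rw [Finset.sum_congr rfl h1, Finset.sum_const, Finset.card_range, nsmul_eq_mul]
    _ ≤ ENNReal.ofReal (2 * R / d) * (ENNReal.ofReal ((2 * R * d) ^ Module.finrank ℝ E) *
          volume (Metric.ball (0 : E) 1)) := by
        gcongr
        rw [← ENNReal.ofReal_natCast]
        apply ENNReal.ofReal_le_ofReal
        rw [hn]; push_cast
        have h1 : (⌊R / d⌋₊ : ℝ) ≤ R / d := Nat.floor_le (by positivity)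
        have h2 : 1 ≤ R / d := by rw [le_div_iff₀ hd]; linarith
        have h3 : 2 * R / d = R / d + R / d := by ring
        linarith
    _ = _ := by
        rw [← mul_assoc, ← ENNReal.ofReal_mul (by positivity),
          mul_right_comm (ENNReal.ofReal (2 * R * (2 * R) ^ Module.finrank ℝ E)),
          ← ENNReal.ofReal_mul (by positivity)]
        congr 2
        rw [Real.rpow_sub_one hd.ne', Real.rpow_natCast, mul_pow (2 * R) d]
        field_simp

/-- The cone over a set of vanishing `(N-1)`-dimensional Hausdorff measure is a null set. -/
theorem volume_coneOver_eq_zero_of_hausdorffMeasure_eq_zero (hN : 2 ≤ Module.finrank ℝ E)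
    {A : Set E} (hA : Measure.hausdorffMeasure ((Module.finrank ℝ E : ℝ) - 1) A = 0) :
    volume (coneOver A) = 0 := by
  have hp : (0 : ℝ) < (Module.finrank ℝ E : ℝ) - 1 := by
    have : (2 : ℝ) ≤ Module.finrank ℝ E := by exact_mod_cast hN
    linarith
  have key : ∀ R : ℝ, 1 ≤ R → truncatedConeOuterMeasure E R A = 0 := by
    intro R hR
    set C : ℝ≥0∞ := ENNReal.ofReal (2 * R * (2 * R) ^ Module.finrank ℝ E) *
      volume (Metric.ball (0 : E) 1) with hC
    have hCtop : C ≠ ∞ := ENNReal.mul_ne_top ENNReal.ofReal_ne_top measure_ball_lt_top.ne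
    have hC0 : C ≠ 0 := by
      refine mul_ne_zero ?_ (Metric.measure_ball_pos _ _ one_pos).ne'
      have : 0 < 2 * R * (2 * R) ^ Module.finrank ℝ E := by positivity
      simpa using this
    have hle : truncatedConeOuterMeasure E R ≤
        OuterMeasure.mkMetric (C • fun r : ℝ≥0∞ => r ^ ((Module.finrank ℝ E : ℝ) - 1)) := by
      refine OuterMeasure.le_mkMetric _ _ 1 one_pos fun S hS => ?_
      have hfin : Metric.ediam S ≠ ∞ := ne_top_of_le_ne_top ENNReal.one_ne_top hS
      have hbound : ∀ d : ℝ, 0 < d → d ≤ 1 → Metric.ediam S ≤ ENNReal.ofReal d →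
          truncatedConeOuterMeasure E R S ≤
            C * ENNReal.ofReal (d ^ ((Module.finrank ℝ E : ℝ) - 1)) := by
        intro d hd hd1 hSd
        refine truncatedConeOuterMeasure_le hR hd hd1 fun x hx y hy => ?_
        have := (Metric.edist_le_ediam_of_mem hx hy).trans hSd
        rwa [edist_dist, ENNReal.ofReal_le_ofReal_iff hd.le] at this
      rcases eq_or_ne (Metric.ediam S) 0 with h0 | h0
      · rw [Pi.smul_apply, h0, ENNReal.zero_rpow_of_pos hp, smul_zero, nonpos_iff_eq_zero]
        have hlim : Tendsto (fun d : ℝ =>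
            C * ENNReal.ofReal (d ^ ((Module.finrank ℝ E : ℝ) - 1))) (𝓝[>] 0) (𝓝 0) := by
          have h1 : Tendsto (fun d : ℝ => d ^ ((Module.finrank ℝ E : ℝ) - 1)) (𝓝[>] 0) (𝓝 0) := by
            have := (Real.continuousAt_rpow_const 0 ((Module.finrank ℝ E : ℝ) - 1)
              (Or.inr hp.le)).tendsto
            rw [Real.zero_rpow hp.ne'] at this
            exact this.mono_left nhdsWithin_le_nhds
          have h2 := ENNReal.Tendsto.const_mul (a := C) (ENNReal.tendsto_ofReal h1)
            (Or.inr hCtop)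
          simpa using h2
        refine le_antisymm (ge_of_tendsto hlim ?_) zero_le
        filter_upwards [Ioo_mem_nhdsGT (zero_lt_one (α := ℝ))] with d hd
        exact hbound d hd.1 hd.2.le (by rw [h0]; exact zero_le)
      · have hpos := ENNReal.toReal_pos h0 hfin
        have h1 := hbound (Metric.ediam S).toReal hpos
          (by simpa using ENNReal.toReal_mono ENNReal.one_ne_top hS)
          (by rw [ENNReal.ofReal_toReal hfin])
        rwa [← ENNReal.ofReal_rpow_of_pos hpos, ENNReal.ofReal_toReal hfin] at h1
    rw [OuterMeasure.mkMetric_smul _ hCtop hC0] at hle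
    have h2 := hle A
    have h3 : OuterMeasure.mkMetric (fun r : ℝ≥0∞ => r ^ ((Module.finrank ℝ E : ℝ) - 1)) A
        = 0 := by
      rw [OuterMeasure.coe_mkMetric]; exact hA
    rw [smul_apply, h3, smul_zero] at h2
    exact nonpos_iff_eq_zero.1 h2
  have hsub : coneOver A ⊆
      ⋃ n : ℕ, {y : E | ∃ s ∈ Icc 0 ((n : ℝ) + 1), ∃ a ∈ A, ‖a‖ ≤ (n : ℝ) + 1 ∧ y = s • a} := by
    rintro y ⟨t, ht, hy⟩
    obtain ⟨n, hn⟩ := exists_nat_ge (max t⁻¹ ‖t • y‖)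
    refine mem_iUnion.2 ⟨n, t⁻¹, ⟨by positivity, ?_⟩, t • y, hy, ?_, ?_⟩
    · linarith [le_max_left t⁻¹ ‖t • y‖]
    · linarith [le_max_right t⁻¹ ‖t • y‖]
    · rw [smul_smul, inv_mul_cancel₀ ht.ne', one_smul]
  refine measure_mono_null hsub (measure_iUnion_null fun n => ?_)
  exact key ((n : ℝ) + 1) (by linarith [Nat.cast_nonneg (α := ℝ) n])

end Rays

/-! ### Boundary points with a normal -/

section Normals

variable {N : ℕ}

local notation "𝔼" => EuclideanSpace ℝ (Fin N)

/-- Along a line through a zero of `φ`, the sign of `φ` is that of the directional derivative. -/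
theorem eventually_sign_of_hasGradientAt {φ : 𝔼 → ℝ} {x g v : 𝔼} (h0 : φ x = 0)
    (hg : HasGradientAt φ g x) (hv : inner ℝ g v < 0) :
    (∀ᶠ s : ℝ in 𝓝[>] 0, φ (x + s • v) < 0) ∧ ∀ᶠ s : ℝ in 𝓝[<] 0, 0 < φ (x + s • v) := by
  have h1 : HasDerivAt (fun s : ℝ => φ (x + s • v)) (inner ℝ g v) 0 := by
    have h2 : HasDerivAt (fun s : ℝ => x + s • v) v 0 := by
      simpa using ((hasDerivAt_id (0 : ℝ)).smul_const v).const_add x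
    have h3 : HasFDerivAt φ (InnerProductSpace.toDual ℝ 𝔼 g) (x + (0 : ℝ) • v) := by
      simpa using hg.hasFDerivAt
    have h4 := h3.comp_hasDerivAt (0 : ℝ) h2
    rwa [InnerProductSpace.toDual_apply_apply] at h4
  have h2 := hasDerivAt_iff_tendsto_slope.1 h1
  have h3 : ∀ᶠ s : ℝ in 𝓝[≠] 0, slope (fun s : ℝ => φ (x + s • v)) 0 s < 0 :=
    h2.eventually (gt_mem_nhds hv)
  constructor
  · filter_upwards [h3.filter_mono (nhdsWithin_mono 0 fun s hs => ne_of_gt hs),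
      self_mem_nhdsWithin] with s hs hs0
    rw [slope_def_field] at hs
    simp only [zero_smul, add_zero, h0, sub_zero] at hs
    exact (div_neg_iff.1 hs).elim (fun h => absurd h.2 (not_lt.2 (le_of_lt hs0))) fun h => h.1
  · filter_upwards [h3.filter_mono (nhdsWithin_mono 0 fun s hs => ne_of_lt hs),
      self_mem_nhdsWithin] with s hs hs0
    rw [slope_def_field] at hs
    simp only [zero_smul, add_zero, h0, sub_zero] at hs
    exact (div_neg_iff.1 hs).elim (fun h => h.1) fun h => absurd h.2 (not_lt.2 (le_of_lt hs0))

theorem tendsto_line (x v : 𝔼) (l : Filter ℝ) (hl : l ≤ 𝓝 0) :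
    Tendsto (fun s : ℝ => x + s • v) l (𝓝 x) := by
  have : Continuous fun s : ℝ => x + s • v := by fun_prop
  have h := this.tendsto 0
  simp only [zero_smul, add_zero] at h
  exact h.mono_left hl

/-- Moving from a boundary point against the normal enters the set. -/
theorem IsUnitOutwardNormal.eventually_mem {Ω : Set 𝔼} {x n v : 𝔼}
    (h : IsUnitOutwardNormal Ω x n) (hv : inner ℝ n v < 0) :
    (∀ᶠ s : ℝ in 𝓝[>] 0, x + s • v ∈ Ω) ∧ ∀ᶠ s : ℝ in 𝓝[<] 0, x + s • v ∉ Ω := by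
  obtain ⟨-, φ, c, hc, -, h0, hg, hΩ⟩ := h
  have h1 := eventually_sign_of_hasGradientAt (v := v) h0 hg (by
    rw [inner_smul_left]; simpa using mul_neg_of_pos_of_neg hc hv)
  constructor
  · filter_upwards [h1.1, (tendsto_line x v _ nhdsWithin_le_nhds).eventually hΩ] with s hs hs'
    exact hs'.2 hs
  · filter_upwards [h1.2, (tendsto_line x v _ nhdsWithin_le_nhds).eventually hΩ] with s hs hs'
    rw [hs']
    exact not_lt.2 hs.le

/-- The gradient of a local defining function of `Ω` is orthogonal to every vector that is
orthogonal to a normal of `Ω`. -/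
theorem IsUnitOutwardNormal.inner_eq_zero {Ω : Set 𝔼} {x n g v : 𝔼}
    (h : IsUnitOutwardNormal Ω x n) {φ : 𝔼 → ℝ} (h0 : φ x = 0) (hg : HasGradientAt φ g x)
    (hΩ : ∀ᶠ y in 𝓝 x, (y ∈ Ω ↔ φ y < 0)) (hv : inner ℝ n v = 0) : inner ℝ g v = 0 := by
  have key : ∀ w : 𝔼, inner ℝ n w = 0 → ¬ inner ℝ g w < 0 := by
    intro w hw hgw
    -- push `w` slightly to the outer side of `n`, keeping it on the inner side of `g`
    have hcont : Continuous fun η : ℝ => inner ℝ g (w + η • n) := by fun_prop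
    have h1 : ∀ᶠ η : ℝ in 𝓝[>] 0, inner ℝ g (w + η • n) < 0 :=
      (hcont.tendsto 0).mono_left nhdsWithin_le_nhds |>.eventually
        (gt_mem_nhds (by simpa using hgw))
    obtain ⟨η, hη, hη0⟩ := (h1.and self_mem_nhdsWithin).exists
    have h2 := (eventually_sign_of_hasGradientAt h0 hg hη).1
    have hneg : inner ℝ n (-(w + η • n)) < 0 := by
      rw [inner_neg_right, inner_add_right, hw, inner_smul_right, real_inner_self_eq_norm_sq, h.1]
      simpa using hη0
    have h3 := (h.eventually_mem hneg).2
    have h4 : ∀ᶠ s : ℝ in 𝓝[>] 0, x + s • (w + η • n) ∉ Ω := by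
      have ht : Tendsto (fun s : ℝ => -s) (𝓝[>] 0) (𝓝[<] 0) := by
        simpa using tendsto_neg_nhdsGT (a := (0 : ℝ))
      filter_upwards [ht.eventually h3] with s hs
      rwa [smul_neg, neg_smul, neg_neg] at hs
    obtain ⟨s, ⟨hs1, hs2⟩, hs3⟩ := ((h2.and h4).and
      ((tendsto_line x (w + η • n) _ nhdsWithin_le_nhds).eventually hΩ)).exists
    exact hs2 (hs3.2 hs1)
  refine le_antisymm ?_ (not_lt.1 (key v hv))
  have := key (-v) (by rw [inner_neg_right, hv, neg_zero])
  rw [inner_neg_right] at this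
  linarith

/-- Two disjoint sets with normals at a common boundary point have opposite normals there. -/
theorem IsUnitOutwardNormal.eq_neg_of_disjoint {Ω Ω' : Set 𝔼} (hd : Disjoint Ω Ω') {x n n' : 𝔼}
    (h : IsUnitOutwardNormal Ω x n) (h' : IsUnitOutwardNormal Ω' x n') : n' = -n := by
  -- otherwise the direction `-(n + n')` enters both sets
  by_contra hne
  have hpos : 0 < 1 + inner ℝ n n' := by
    have h1 : 0 < ‖n + n'‖ ^ 2 := by
      refine pow_pos (norm_pos_iff.2 fun h0 => hne ?_) 2
      rw [eq_neg_iff_add_eq_zero, add_comm]; exact h0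
    rw [norm_add_sq_real, h.1, h'.1] at h1
    linarith
  have e1 : inner ℝ n (-(n + n')) < 0 := by
    rw [inner_neg_right, inner_add_right, real_inner_self_eq_norm_sq, h.1]; linarith
  have e2 : inner ℝ n' (-(n + n')) < 0 := by
    rw [inner_neg_right, inner_add_right, real_inner_self_eq_norm_sq, h'.1, real_inner_comm]
    linarith
  obtain ⟨s, hs1, hs2⟩ := ((h.eventually_mem e1).1.and (h'.eventually_mem e2).1).exists
  exact disjoint_left.1 hd hs1 hs2

theorem eq_zero_of_mem_frontier {Ω : Set 𝔼} {φ : 𝔼 → ℝ} {y : 𝔼} (hy : y ∈ frontier Ω)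
    (hφ : ContinuousAt φ y) (hΩ : ∀ᶠ z in 𝓝 y, (z ∈ Ω ↔ φ z < 0)) : φ y = 0 := by
  rcases lt_trichotomy (φ y) 0 with h | h | h
  · exfalso
    have : Ω ∈ 𝓝 y := by
      filter_upwards [hΩ, hφ.eventually (gt_mem_nhds h)] with z hz1 hz2
      exact hz1.2 hz2
    exact hy.2 (mem_interior_iff_mem_nhds.2 this)
  · exact h
  · exfalso
    have : ∀ᶠ z in 𝓝 y, z ∉ Ω := by
      filter_upwards [hΩ, hφ.eventually (lt_mem_nhds h)] with z hz1 hz2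
      rw [hz1]; exact not_lt.2 (le_of_lt hz2)
    obtain ⟨z, hz1, hz2⟩ := ((mem_closure_iff_frequently.1 hy.1).and_eventually this).exists
    exact hz2 hz1

/-- The points of a smooth hypersurface `{φ = 0}` at which the radial direction is tangential span
a null cone. In coordinates that flatten the hypersurface, the cone is the image of a set on which
the map `(p, s) ↦ eˢ G(p)` has a singular differential, so that Sard's lemma applies. -/
theorem exists_nhds_volume_coneOver_eq_zero {φ : 𝔼 → ℝ} {x n : 𝔼} {c : ℝ} (hn : ‖n‖ = 1)
    (hc : 0 < c) (hφ : ContDiffAt ℝ 1 φ x) (hg : HasGradientAt φ (c • n) x) :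
    ∃ U ∈ 𝓝 x, volume (coneOver {y | y ∈ U ∧ φ y = 0 ∧ fderiv ℝ φ y y = 0}) = 0 := by
  have hnn : inner ℝ n n = (1 : ℝ) := by rw [real_inner_self_eq_norm_sq, hn]; norm_num
  -- `Ψ` replaces the coordinate along `n` by `φ`, so that it flattens the hypersurface
  set Ψ : 𝔼 → 𝔼 := fun y => y + (φ y - inner ℝ n y) • n with hΨ
  have hΨc : ContDiffAt ℝ 1 Ψ x := by
    have : ContDiffAt ℝ 1 (fun y : 𝔼 => inner ℝ n y) x :=
      (innerSL ℝ n).contDiff.contDiffAt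
    exact contDiffAt_id.add ((hφ.sub this).smul contDiffAt_const)
  -- the differential of `Ψ` at a point where `φ` has differential `L`
  have hder : ∀ (y : 𝔼), DifferentiableAt ℝ φ y → HasFDerivAt Ψ
      (ContinuousLinearMap.id ℝ 𝔼 + (fderiv ℝ φ y - innerSL ℝ n).smulRight n) y := by
    intro y hy
    exact (hasFDerivAt_id y).add ((hy.hasFDerivAt.sub (innerSL ℝ n).hasFDerivAt).smul_const n)
  -- the differential of `Ψ` at `x` is the dilation by `c` along `n`
  set e : 𝔼 ≃L[ℝ] 𝔼 := ContinuousLinearEquiv.equivOfInverse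
    (ContinuousLinearMap.id ℝ 𝔼 + ((c - 1) • innerSL ℝ n).smulRight n)
    (ContinuousLinearMap.id ℝ 𝔼 + ((c⁻¹ - 1) • innerSL ℝ n).smulRight n)
    (fun v => by
      simp only [add_apply, ContinuousLinearMap.id_apply,
        ContinuousLinearMap.smulRight_apply, smul_apply, innerSL_apply_apply,
        inner_add_right, inner_smul_right, hnn, smul_eq_mul, add_assoc, ← add_smul]
      convert add_zero v using 2
      convert zero_smul ℝ n using 2
      field_simp; ring)
    (fun v => by
      simp only [add_apply, ContinuousLinearMap.id_apply,
        ContinuousLinearMap.smulRight_apply, smul_apply, innerSL_apply_apply,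
        inner_add_right, inner_smul_right, hnn, smul_eq_mul, add_assoc, ← add_smul]
      convert add_zero v using 2
      convert zero_smul ℝ n using 2
      field_simp; ring) with he
  have hex : HasFDerivAt Ψ (e : 𝔼 →L[ℝ] 𝔼) x := by
    convert hder x (hφ.differentiableAt one_ne_zero) using 1
    ext1 v
    have : fderiv ℝ φ x = InnerProductSpace.toDual ℝ 𝔼 (c • n) := hg.hasFDerivAt.fderiv
    have hev : (e : 𝔼 →L[ℝ] 𝔼) v = v + ((c - 1) * inner ℝ n v) • n := rfl
    rw [hev]
    simp only [add_apply, ContinuousLinearMap.id_apply, ContinuousLinearMap.smulRight_apply,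
      innerSL_apply_apply, this, sub_apply, InnerProductSpace.toDual_apply_apply,
      inner_smul_left, conj_trivial, sub_mul, one_mul]
  set ψ := hΨc.toOpenPartialHomeomorph Ψ hex one_ne_zero with hψ
  have hψc : (ψ : 𝔼 → 𝔼) = Ψ := rfl
  have hxs : x ∈ ψ.source := hΨc.mem_toOpenPartialHomeomorph_source hex one_ne_zero
  have hGc : ContDiffAt ℝ 1 ψ.symm (Ψ x) := hΨc.to_localInverse hex one_ne_zero
  have hGe : ∀ᶠ y in 𝓝 x, DifferentiableAt ℝ ψ.symm (Ψ y) := by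
    have h1 : ∀ᶠ z in 𝓝 (Ψ x), DifferentiableAt ℝ ψ.symm z := by
      filter_upwards [hGc.eventually (by simp)] with z hz
      exact hz.differentiableAt one_ne_zero
    exact hΨc.continuousAt.eventually h1
  have hφe : ∀ᶠ y in 𝓝 x, DifferentiableAt ℝ φ y := by
    filter_upwards [hφ.eventually (by simp)] with z hz
    exact hz.differentiableAt one_ne_zero
  refine ⟨_, (hGe.and hφe).and (ψ.open_source.mem_nhds hxs), ?_⟩
  set A : Set 𝔼 := {y | y ∈ {y | (DifferentiableAt ℝ ψ.symm (Ψ y) ∧ DifferentiableAt ℝ φ y) ∧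
    y ∈ ψ.source} ∧ φ y = 0 ∧ fderiv ℝ φ y y = 0} with hA
  set P : 𝔼 →L[ℝ] 𝔼 := ContinuousLinearMap.id ℝ 𝔼 - (innerSL ℝ n).smulRight n with hP
  have hPn : ∀ v, P v = v - inner ℝ n v • n := fun v => by simp [hP]
  -- the coordinate along `n`, unused on the hypersurface, serves as the parameter of the rays
  set F : 𝔼 → 𝔼 := fun z => Real.exp (inner ℝ n z) • ψ.symm (P z) with hF
  set T : Set 𝔼 := {z | ∃ y ∈ A, P z = Ψ y} with hT
  have hsub : coneOver A ⊆ F '' T := by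
    rintro w ⟨t, ht, hw⟩
    have hφ0 : φ (t • w) = 0 := hw.2.1
    have hΨw : Ψ (t • w) = t • w - inner ℝ n (t • w) • n := by
      simp only [hΨ, hφ0, zero_sub, neg_smul, ← sub_eq_add_neg]
    have hin : inner ℝ n (Ψ (t • w)) = (0 : ℝ) := by
      rw [hΨw, inner_sub_right, inner_smul_right _ n, hnn]; ring
    have hPz : P (Ψ (t • w) + (-Real.log t) • n) = Ψ (t • w) := by
      rw [hPn, inner_add_right, hin, inner_smul_right, hnn, zero_add, mul_one, add_sub_cancel_right]
    refine ⟨Ψ (t • w) + (-Real.log t) • n, ⟨t • w, hw, hPz⟩, ?_⟩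
    simp only [hF]
    rw [hPz, inner_add_right, hin, inner_smul_right, hnn, zero_add, mul_one, Real.exp_neg,
      Real.exp_log ht, ← hψc, ψ.left_inv hw.1.2, smul_smul, inv_mul_cancel₀ ht.ne', one_smul]
  refine measure_mono_null hsub ?_
  refine addHaar_image_eq_zero_of_det_fderivWithin_eq_zero (f := F)
    (f' := fun z => Real.exp (inner ℝ n z) • ((fderiv ℝ ψ.symm (P z)).comp P) +
      (Real.exp (inner ℝ n z) • innerSL ℝ n).smulRight (ψ.symm (P z))) volume ?_ ?_
  · rintro z ⟨y, hy, hzy⟩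
    have h1 : HasFDerivAt (fun z : 𝔼 => Real.exp (inner ℝ n z))
        (Real.exp (inner ℝ n z) • innerSL ℝ n) z := (innerSL ℝ n).hasFDerivAt.exp
    have h2 : HasFDerivAt (fun z => ψ.symm (P z)) ((fderiv ℝ ψ.symm (P z)).comp P) z := by
      have : DifferentiableAt ℝ ψ.symm (P z) := by rw [hzy]; exact hy.1.1.1
      exact this.hasFDerivAt.comp z P.hasFDerivAt
    exact (h1.smul h2).hasFDerivWithinAt
  · rintro z ⟨y, hy, hzy⟩
    have hGy : ψ.symm (Ψ y) = y := ψ.left_inv hy.1.2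
    -- the direction `n - DΨ(y) y` lies in the kernel
    have hchain : fderiv ℝ ψ.symm (Ψ y) (y - inner ℝ n y • n) = y := by
      have h1 : HasFDerivAt (fun w => ψ.symm (Ψ w)) _ y :=
        hy.1.1.1.hasFDerivAt.comp y (hder y hy.1.1.2)
      have h2 : HasFDerivAt (fun w => ψ.symm (Ψ w)) (ContinuousLinearMap.id ℝ 𝔼) y := by
        refine (hasFDerivAt_id y).congr_of_eventuallyEq ?_
        filter_upwards [ψ.open_source.mem_nhds hy.1.2] with w hw
        exact ψ.left_inv hw
      have h3 := congrArg (fun L : 𝔼 →L[ℝ] 𝔼 => L y) (h1.unique h2)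
      simpa [hy.2.2, sub_eq_add_neg] using h3
    set v : 𝔼 := n - (y - inner ℝ n y • n) with hv
    have hnv : inner ℝ n v = (1 : ℝ) := by
      rw [hv, inner_sub_right, inner_sub_right, inner_smul_right, hnn]; ring
    have hv0 : v ≠ 0 := by
      intro h; rw [h, inner_zero_right] at hnv; exact zero_ne_one hnv
    have hPv : P v = -(y - inner ℝ n y • n) := by
      rw [hPn, hnv, hv]; simp
    refine LinearMap.det_eq_zero_iff_ker_ne_bot.2 fun hbot => hv0 ?_
    have hmem : v ∈ LinearMap.ker ((Real.exp (inner ℝ n z) • ((fderiv ℝ ψ.symm (P z)).comp P) +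
        (Real.exp (inner ℝ n z) • innerSL ℝ n).smulRight (ψ.symm (P z)) : 𝔼 →L[ℝ] 𝔼) :
          𝔼 →ₗ[ℝ] 𝔼) := by
      rw [LinearMap.mem_ker, ContinuousLinearMap.coe_coe]
      simp only [add_apply, smul_apply, ContinuousLinearMap.comp_apply,
        ContinuousLinearMap.smulRight_apply, innerSL_apply_apply, hPv, hnv, hzy, hGy, map_neg,
        hchain, smul_eq_mul, mul_one, smul_neg, neg_add_cancel]
    rw [hbot] at hmem
    exact (Submodule.mem_bot ℝ).1 hmem

/-- Almost every ray from the origin avoids the boundary points at which the radial direction is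
orthogonal to a normal. -/
theorem volume_coneOver_tangential_eq_zero (Ω : Set 𝔼) :
    volume (coneOver {x | x ∈ frontier Ω ∧ ∃ n, IsUnitOutwardNormal Ω x n ∧
      inner ℝ n x = (0 : ℝ)}) = 0 := by
  rw [← coneOuterMeasure_apply]
  refine measure_null_of_locally_null _ ?_
  rintro x ⟨-, n, ⟨hn, φ, c, hc, hφ, h0, hg, hΩ⟩, -⟩
  obtain ⟨U, hU, hU0⟩ := exists_nhds_volume_coneOver_eq_zero hn hc hφ hg
  have h1 : ∀ᶠ y in 𝓝 x, ContDiffAt ℝ 1 φ y := hφ.eventually (by simp)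
  have h2 : ∀ᶠ y in 𝓝 x, y ∈ U ∧ DifferentiableAt ℝ φ y ∧
      ∀ᶠ z in 𝓝 y, (z ∈ Ω ↔ φ z < 0) := by
    filter_upwards [hU, h1, hΩ.eventually_nhds] with y hy1 hy2 hy3
    exact ⟨hy1, hy2.differentiableAt one_ne_zero, hy3⟩
  refine ⟨_, inter_mem_nhdsWithin _ h2, ?_⟩
  rw [coneOuterMeasure_apply]
  refine measure_mono_null ?_ hU0
  rintro w ⟨t, ht, ⟨hfr, m, hm, hmw⟩, hyU, hyd, hyΩ⟩
  have hy0 : φ (t • w) = 0 := eq_zero_of_mem_frontier hfr hyd.continuousAt hyΩ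
  refine ⟨t, ht, hyU, hy0, ?_⟩
  have := hm.inner_eq_zero hy0 hyd.hasGradientAt hyΩ hmw
  rwa [inner_gradient_left] at this

end Normals

/-! ### Layered media along rays -/

namespace IsLayeredMedium

variable {N : ℕ} {L : Set ℤ} {Ω Sm Sp : ℤ → Set (EuclideanSpace ℝ (Fin N))} {ν : ℤ → ℝ}
  {μ₀ : EuclideanSpace ℝ (Fin N) → ℝ}

/-- The ray through `x` meets the separating surfaces only at smooth points, and transversally. -/
def IsTransversalRay (L : Set ℤ) (Ω : ℤ → Set (EuclideanSpace ℝ (Fin N)))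
    (x : EuclideanSpace ℝ (Fin N)) : Prop :=
  ∀ t : ℝ, 0 < t → ∀ ℓ ∈ L, t • x ∈ frontier (Ω ℓ) →
    ∃ n, IsUnitOutwardNormal (Ω ℓ) (t • x) n ∧ inner ℝ n x ≠ (0 : ℝ)

/-- Almost every ray is transversal: nonsmooth and tangential boundary points span null cones. -/
theorem ae_isTransversalRay (hN : 2 ≤ N) (h : IsLayeredMedium L Ω Sm Sp ν μ₀) :
    ∀ᵐ x, IsTransversalRay L Ω x := by
  have h1 : ∀ ℓ ∈ L, ∀ᵐ x, x ∉ coneOver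
      {x | x ∈ frontier (Ω ℓ) ∧ ¬ ∃ n, IsUnitOutwardNormal (Ω ℓ) x n} := fun ℓ hℓ => by
    rw [← measure_eq_zero_iff_ae_notMem]
    refine volume_coneOver_eq_zero_of_hausdorffMeasure_eq_zero (by simpa using hN) ?_
    rw [finrank_euclideanSpace_fin]
    exact h.smooth_ae ℓ hℓ
  have h2 : ∀ ℓ ∈ L, ∀ᵐ x, x ∉ coneOver {x | x ∈ frontier (Ω ℓ) ∧
      ∃ n, IsUnitOutwardNormal (Ω ℓ) x n ∧ inner ℝ n x = (0 : ℝ)} := fun ℓ _ => by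
    rw [← measure_eq_zero_iff_ae_notMem]
    exact volume_coneOver_tangential_eq_zero (Ω ℓ)
  have h1' := (ae_ball_iff L.to_countable).2 h1
  have h2' := (ae_ball_iff L.to_countable).2 h2
  filter_upwards [h1', h2'] with x hx1 hx2 t ht ℓ hℓ hfr
  by_contra hcon
  push Not at hcon
  by_cases hn : ∃ n, IsUnitOutwardNormal (Ω ℓ) (t • x) n
  · obtain ⟨n, hn⟩ := hn
    exact hx2 ℓ hℓ ⟨t, ht, hfr, n, hn, by rw [inner_smul_right, hcon n hn, mul_zero]⟩
  · exact hx1 ℓ hℓ ⟨t, ht, hfr, hn⟩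

theorem exists_mem_closure (h : IsLayeredMedium L Ω Sm Sp ν μ₀)
    (y : EuclideanSpace ℝ (Fin N)) : ∃ ℓ ∈ L, y ∈ closure (Ω ℓ) := by
  have : y ∈ ⋃ ℓ ∈ L, closure (Ω ℓ) := by rw [h.cover]; trivial
  simpa using this

theorem eq_of_mem (h : IsLayeredMedium L Ω Sm Sp ν μ₀) {k ℓ : ℤ} (hk : k ∈ L) (hℓ : ℓ ∈ L)
    {y : EuclideanSpace ℝ (Fin N)} (h1 : y ∈ Ω k) (h2 : y ∈ Ω ℓ) : k = ℓ := by
  by_contra hne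
  exact disjoint_left.1 (h.disjoint k hk ℓ hℓ hne) h1 h2

/-- Around each of its points a transversal ray leaves one layer and enters another one, and the
coefficient does not decrease. -/
theorem IsTransversalRay.crossing (h : IsLayeredMedium L Ω Sm Sp ν μ₀)
    {x : EuclideanSpace ℝ (Fin N)} (hx : IsTransversalRay L Ω x) {t : ℝ} (ht : 0 < t) :
    ∃ k ∈ L, ∃ k' ∈ L, ν k ≤ ν k' ∧ (∀ᶠ s : ℝ in 𝓝[<] t, s • x ∈ Ω k) ∧
      ∀ᶠ s : ℝ in 𝓝[>] t, s • x ∈ Ω k' := by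
  have hcont : Tendsto (fun s : ℝ => s • x) (𝓝 t) (𝓝 (t • x)) := by
    have : Continuous fun s : ℝ => s • x := by fun_prop
    exact this.tendsto t
  obtain ⟨ℓ₀, hℓ₀, hcl⟩ := h.exists_mem_closure (t • x)
  by_cases hmem : t • x ∈ Ω ℓ₀
  · have h1 : ∀ᶠ s : ℝ in 𝓝 t, s • x ∈ Ω ℓ₀ :=
      hcont.eventually ((h.isOpen ℓ₀ hℓ₀).mem_nhds hmem)
    exact ⟨ℓ₀, hℓ₀, ℓ₀, hℓ₀, le_rfl, h1.filter_mono nhdsWithin_le_nhds,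
      h1.filter_mono nhdsWithin_le_nhds⟩
  -- the two layers which meet at the boundary point `t • x`
  have hfr : t • x ∈ frontier (Ω ℓ₀) := by
    rw [(h.isOpen ℓ₀ hℓ₀).frontier_eq]; exact ⟨hcl, hmem⟩
  obtain ⟨ℓ, hℓ, hℓ1, hS⟩ : ∃ ℓ, ℓ ∈ L ∧ ℓ + 1 ∈ L ∧ t • x ∈ Sp ℓ := by
    have hS := hfr
    rw [h.frontier_eq ℓ₀ hℓ₀] at hS
    rcases hS with hS | hS
    · by_cases hL : ℓ₀ - 1 ∈ L
      · refine ⟨ℓ₀ - 1, hL, by simpa using hℓ₀, ?_⟩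
        rw [h.surface_eq _ hL (by simpa using hℓ₀)]
        simpa using hS
      · rw [h.surface_first ℓ₀ hℓ₀ hL] at hS
        exact absurd hS (notMem_empty _)
    · by_cases hL : ℓ₀ + 1 ∈ L
      · exact ⟨ℓ₀, hℓ₀, hL, hS⟩
      · rw [h.surface_last ℓ₀ hℓ₀ hL] at hS
        exact absurd hS (notMem_empty _)
  obtain ⟨n, hn, hnx⟩ := hx t ht ℓ hℓ (by rw [h.frontier_eq ℓ hℓ]; exact Or.inr hS)
  obtain ⟨n', hn', -⟩ := hx t ht (ℓ + 1) hℓ1 (by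
    rw [h.frontier_eq _ hℓ1, ← h.surface_eq ℓ hℓ hℓ1]; exact Or.inl hS)
  have hnn : n' = -n := hn.eq_neg_of_disjoint (h.disjoint ℓ hℓ (ℓ + 1) hℓ1 (by omega)) hn'
  have hmono := h.monotone ℓ hℓ hℓ1 _ hS n hn
  rw [inner_smul_right] at hmono
  have hleft : ∀ {A : Set (EuclideanSpace ℝ (Fin N))} {m : EuclideanSpace ℝ (Fin N)},
      IsUnitOutwardNormal A (t • x) m → 0 < inner ℝ m x → ∀ᶠ s : ℝ in 𝓝[<] t, s • x ∈ A := by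
    intro A m hm hpos
    have h1 := (hm.eventually_mem (v := -x) (by rw [inner_neg_right]; linarith)).1
    have h2 : Tendsto (fun s : ℝ => t - s) (𝓝[<] t) (𝓝[>] 0) := by
      have h3 : Continuous fun s : ℝ => t - s := by fun_prop
      refine tendsto_nhdsWithin_iff.2 ⟨?_, ?_⟩
      · simpa using (h3.tendsto t).mono_left nhdsWithin_le_nhds
      · filter_upwards [self_mem_nhdsWithin] with s hs
        exact sub_pos.2 (by simpa using hs)
    filter_upwards [h2.eventually h1] with s hs
    rwa [smul_neg, ← sub_eq_add_neg, ← sub_smul, sub_sub_cancel] at hs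
  have hright : ∀ {A : Set (EuclideanSpace ℝ (Fin N))} {m : EuclideanSpace ℝ (Fin N)},
      IsUnitOutwardNormal A (t • x) m → inner ℝ m x < 0 → ∀ᶠ s : ℝ in 𝓝[>] t, s • x ∈ A := by
    intro A m hm hneg
    have h1 := (hm.eventually_mem hneg).1
    have h2 : Tendsto (fun s : ℝ => s - t) (𝓝[>] t) (𝓝[>] 0) := by
      have h3 : Continuous fun s : ℝ => s - t := by fun_prop
      refine tendsto_nhdsWithin_iff.2 ⟨?_, ?_⟩
      · simpa using (h3.tendsto t).mono_left nhdsWithin_le_nhds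
      · filter_upwards [self_mem_nhdsWithin] with s hs
        exact sub_pos.2 (by simpa using hs)
    filter_upwards [h2.eventually h1] with s hs
    rwa [← add_smul, add_sub_cancel] at hs
  rcases lt_or_gt_of_ne hnx with hneg | hpos
  · refine ⟨ℓ + 1, hℓ1, ℓ, hℓ, ?_, hleft hn' ?_, hright hn hneg⟩
    · by_contra hcon
      push Not at hcon
      have : 0 < (ν ℓ - ν (ℓ + 1)) * (t * inner ℝ n x) :=
        mul_pos_of_neg_of_neg (by linarith) (mul_neg_of_pos_of_neg ht hneg)
      linarith
    · rw [hnn, inner_neg_left]; linarith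
  · refine ⟨ℓ, hℓ, ℓ + 1, hℓ1, ?_, hleft hn hpos, hright hn' ?_⟩
    · by_contra hcon
      push Not at hcon
      have : 0 < (ν ℓ - ν (ℓ + 1)) * (t * inner ℝ n x) :=
        mul_pos (by linarith) (mul_pos ht hpos)
      linarith
    · rw [hnn, inner_neg_left]; linarith

/-- Almost every point lies in a layer. -/
theorem ae_exists_mem (hN : 2 ≤ N) (h : IsLayeredMedium L Ω Sm Sp ν μ₀) :
    ∀ᵐ x, ∃ ℓ ∈ L, x ∈ Ω ℓ := by
  have hop : IsOpen (⋃ ℓ ∈ L, Ω ℓ) := isOpen_biUnion h.isOpen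
  have key : ∀ᵐ x, x ∉ (⋃ ℓ ∈ L, Ω ℓ)ᶜ := by
    refine ae_notMem_of_ae_ae_smul hop.measurableSet.compl ?_
    filter_upwards [h.ae_isTransversalRay hN] with x hx
    rw [ae_restrict_iff' measurableSet_Ioi]
    -- the exceptional parameters are isolated, hence countably many
    set Z : Set ℝ := {t | 0 < t ∧ t • x ∈ (⋃ ℓ ∈ L, Ω ℓ)ᶜ} with hZ
    have hZ0 : volume Z = 0 := by
      refine measure_null_of_locally_null _ fun t ht => ?_
      obtain ⟨k, hk, k', hk', -, h1, h2⟩ := IsTransversalRay.crossing h hx ht.1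
      have h3 : ∀ᶠ s : ℝ in 𝓝[≠] t, s • x ∈ ⋃ ℓ ∈ L, Ω ℓ := by
        rw [← nhdsLT_sup_nhdsGT, eventually_sup]
        exact ⟨h1.mono fun s hs => mem_biUnion hk hs, h2.mono fun s hs => mem_biUnion hk' hs⟩
      rw [eventually_nhdsWithin_iff] at h3
      refine ⟨_, inter_mem_nhdsWithin Z h3, measure_mono_null ?_ (measure_singleton t)⟩
      rintro s ⟨hs, hs'⟩
      by_contra hne
      exact hs.2 (hs' hne)
    filter_upwards [measure_eq_zero_iff_ae_notMem.1 hZ0] with t ht ht0 hcon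
    exact ht ⟨ht0, hcon⟩
  filter_upwards [key] with x hx
  simpa using hx

/-- Let `f k` be functions of the position on a transversal ray which increase inside the layer
`Ω k` and are ordered as the coefficients `ν k`. Then the function given by `f k` on `Ω k`
increases along the ray. -/
theorem IsTransversalRay.le_of_mem (h : IsLayeredMedium L Ω Sm Sp ν μ₀)
    {x : EuclideanSpace ℝ (Fin N)} (hx : IsTransversalRay L Ω x) {f : ℤ → ℝ → ℝ}
    (hf : ∀ k ∈ L, ∀ k' ∈ L, ν k ≤ ν k' → ∀ t, 0 < t → f k t ≤ f k' t)
    (hf' : ∀ k ∈ L, ∀ r s : ℝ, 0 < r → r < s → (∀ t ∈ Ioo r s, t • x ∈ Ω k) → f k r ≤ f k s)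
    {a b : ℝ} (ha : 0 < a) (hab : a ≤ b) {i j : ℤ} (hi : i ∈ L) (hj : j ∈ L)
    (hai : a • x ∈ Ω i) (hbj : b • x ∈ Ω j) : f i a ≤ f j b := by
  -- `κ t` is the layer which the ray enters after the parameter `t`
  have hex : ∀ t : ℝ, ∃ k, 0 < t → k ∈ L ∧ ∀ᶠ s : ℝ in 𝓝[>] t, s • x ∈ Ω k := by
    intro t
    by_cases ht : 0 < t
    · obtain ⟨k, hk, k', hk', -, h1, h2⟩ := IsTransversalRay.crossing h hx ht
      exact ⟨k', fun _ => ⟨hk', h2⟩⟩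
    · exact ⟨0, fun h => absurd h ht⟩
  choose κ hκ using hex
  have hκu : ∀ t : ℝ, 0 < t → ∀ k ∈ L, t • x ∈ Ω k → κ t = k := by
    intro t ht k hk hm
    have hcont : Tendsto (fun s : ℝ => s • x) (𝓝[>] t) (𝓝 (t • x)) := by
      have : Continuous fun s : ℝ => s • x := by fun_prop
      exact (this.tendsto t).mono_left nhdsWithin_le_nhds
    obtain ⟨s, hs1, hs2⟩ := ((hcont.eventually ((h.isOpen k hk).mem_nhds hm)).and
      (hκ t ht).2).exists
    exact h.eq_of_mem (hκ t ht).1 hk hs2 hs1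
  have hb : 0 < b := ha.trans_le hab
  have key : f (κ a) a ≤ f (κ b) b := by
    refine le_of_forall_eventually_le (f := fun t => f (κ t) t) hab (fun t ht => ?_)
      fun t ht => ?_
    · have ht0 : 0 < t := ha.trans_le ht.1
      obtain ⟨d, hd, hd'⟩ := mem_nhdsGT_iff_exists_Ioo_subset.1 (hκ t ht0).2
      filter_upwards [Ioo_mem_nhdsGT (show t < d from hd)] with s hs
      rw [hκu s (ht0.trans hs.1) _ (hκ t ht0).1 (hd' hs)]
      exact hf' _ (hκ t ht0).1 t s ht0 hs.1 fun r hr => hd' ⟨hr.1, hr.2.trans hs.2⟩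
    · have ht0 : 0 < t := ha.trans ht.1
      obtain ⟨k, hk, k', hk', hle, h1, h2⟩ := IsTransversalRay.crossing h hx ht0
      have hkk : κ t = k' := by
        obtain ⟨s, hs1, hs2⟩ := (h2.and (hκ t ht0).2).exists
        exact h.eq_of_mem (hκ t ht0).1 hk' hs2 hs1
      obtain ⟨d, hd, hd'⟩ := mem_nhdsLT_iff_exists_Ioo_subset.1 h1
      filter_upwards [Ioo_mem_nhdsLT (show d < t from hd), Ioo_mem_nhdsLT ht0] with s hs hs0
      rw [hκu s hs0.1 k hk (hd' hs), hkk]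
      exact (hf' k hk s t hs0.1 hs.2 fun r hr => hd' ⟨hs.1.trans hr.1, hr.2⟩).trans
        (hf k hk k' hk' hle t ht0)
  rwa [hκu a ha i hi hai, hκu b hb j hj hbj] at key

/-- A layered coefficient is nondecreasing along almost every ray. -/
theorem ae_le_smul (hN : 2 ≤ N) (h : IsLayeredMedium L Ω Sm Sp ν μ₀) {s : ℝ} (hs : 1 < s) :
    ∀ᵐ x, μ₀ x ≤ μ₀ (s • x) := by
  have hmem := h.ae_exists_mem hN
  filter_upwards [h.ae_isTransversalRay hN, hmem,
    ae_smul_of_ae hmem (show s ≠ 0 by linarith)] with x hx ⟨i, hi, hxi⟩ ⟨j, hj, hxj⟩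
  rw [h.value i hi x hxi, h.value j hj _ hxj]
  exact IsTransversalRay.le_of_mem h hx (f := fun k _ => ν k)
    (fun k _ k' _ hle _ _ => hle) (fun k _ r s _ _ _ => le_rfl) one_pos hs.le hi hj
    (by simpa using hxi) hxj

/-- If `μ + r ∂μ₁/∂r ≥ 0` almost everywhere, then `r μ` is nondecreasing along almost every ray:
it jumps upwards at the separating surfaces and has a nonnegative derivative elsewhere. -/
theorem ae_le_mul_smul (hN : 2 ≤ N) (h : IsLayeredMedium L Ω Sm Sp ν μ₀)
    {μ μ₁ : EuclideanSpace ℝ (Fin N) → ℝ} (hsum : ∀ x, μ x = μ₀ x + μ₁ x)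
    (hd : Differentiable ℝ μ₁)
    (hr : ∀ᵐ x, 0 ≤ μ x + ‖x‖ * fderiv ℝ μ₁ x (‖x‖⁻¹ • x)) {s : ℝ} (hs : 1 < s) :
    ∀ᵐ x, μ x ≤ s * μ (s • x) := by
  have hmem := h.ae_exists_mem hN
  have hr' : ∀ᵐ x, 0 ≤ μ x + fderiv ℝ μ₁ x x := by
    filter_upwards [hr] with x hx
    -- at `x = 0` the radial derivative is the junk value `0`, in agreement with `fderiv ℝ μ₁ 0 0`
    rcases eq_or_ne x 0 with rfl | h0
    · simpa using hx
    · rwa [map_smul, smul_eq_mul, ← mul_assoc, mul_inv_cancel₀ (norm_ne_zero_iff.2 h0),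
        one_mul] at hx
  filter_upwards [h.ae_isTransversalRay hN, hmem,
    ae_smul_of_ae hmem (show s ≠ 0 by linarith), ae_ae_smul_of_ae hr'] with
    x hx ⟨i, hi, hxi⟩ ⟨j, hj, hxj⟩ hray
  rw [ae_restrict_iff' measurableSet_Ioi] at hray
  rw [hsum x, hsum (s • x), h.value i hi x hxi, h.value j hj _ hxj]
  have key := IsTransversalRay.le_of_mem h hx (f := fun k t => t * (ν k + μ₁ (t • x)))
    (fun k _ k' _ hle t ht => by gcongr) ?_ one_pos hs.le hi hj
    (by simpa using hxi) hxj
  · simpa using key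
  · intro k hk a b ha hab hΩ
    refine le_of_hasDerivAt_of_ae_nonneg (f := fun t => t * (ν k + μ₁ (t • x)))
      (f' := fun t => 1 * (ν k + μ₁ (t • x)) + t * fderiv ℝ μ₁ (t • x) x) hab.le
      (fun t _ => ?_) ?_
    · have h1 : HasDerivAt (fun t : ℝ => μ₁ (t • x)) (fderiv ℝ μ₁ (t • x) x) t := by
        have h2 : HasDerivAt (fun t : ℝ => t • x) x t := by
          simpa using (hasDerivAt_id t).smul_const x
        exact (hd (t • x)).hasFDerivAt.comp_hasDerivAt t h2
      exact (hasDerivAt_id t).mul (h1.const_add (ν k))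
    · filter_upwards [hray] with t ht hmem
      have := ht (ha.trans hmem.1)
      rwa [hsum, h.value k hk _ (hΩ t hmem), map_smul, smul_eq_mul, ← one_mul (ν k + _)] at this

end IsLayeredMedium

/-! ### Approximation of `H²` functions by Schwartz functions -/

section Approximation

variable {N : ℕ}

local notation "𝔼" => EuclideanSpace ℝ (Fin N)

/-- A Fourier multiplier with a bounded symbol is bounded for the `L²` norm (Plancherel). -/
theorem norm_toLp_fourierMultiplierCLM_le {g : 𝔼 → ℂ} (hg : g.HasTemperateGrowth) {C : ℝ}
    (hC : ∀ x, ‖g x‖ ≤ C) (f : 𝓢(𝔼, ℂ)) :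
    ‖(SchwartzMap.fourierMultiplierCLM ℂ g f).toLp 2 volume‖ ≤ C * ‖f.toLp 2 volume‖ := by
  rw [← SchwartzMap.norm_fourier_toL2_eq, ← SchwartzMap.norm_fourier_toL2_eq f,
    SchwartzMap.fourierMultiplierCLM_apply, FourierTransform.fourier_fourierInv_eq]
  refine Lp.norm_le_mul_norm_of_ae_le_mul ?_
  filter_upwards [(SchwartzMap.smulLeftCLM ℂ g (𝓕 f)).coeFn_toLp 2 volume,
    (𝓕 f).coeFn_toLp 2 volume] with x h1 h2
  rw [h1, h2, SchwartzMap.smulLeftCLM_apply_apply hg, norm_smul]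
  gcongr
  exact hC x

/-- An operator on Schwartz functions which is bounded for the `L²` norm maps `L²`-convergent
sequences to `L²`-convergent sequences. -/
theorem exists_tendsto_toLp {T : 𝓢(𝔼, ℂ) →L[ℂ] 𝓢(𝔼, ℂ)} {C : ℝ}
    (hT : ∀ f, ‖(T f).toLp 2 volume‖ ≤ C * ‖f.toLp 2 volume‖) {s : ℕ → 𝓢(𝔼, ℂ)}
    {f : Lp ℂ 2 (volume : Measure 𝔼)}
    (hs : Tendsto (fun n => (s n).toLp 2 volume) atTop (𝓝 f)) :
    ∃ w : Lp ℂ 2 (volume : Measure 𝔼), Tendsto (fun n => (T (s n)).toLp 2 volume) atTop (𝓝 w) := by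
  apply cauchySeq_tendsto_of_complete
  have hC : 0 ≤ |C| + 1 := by positivity
  have key : ∀ a b, dist ((T (s a)).toLp 2 volume) ((T (s b)).toLp 2 volume) ≤
      (|C| + 1) * dist ((s a).toLp 2 volume) ((s b).toLp 2 volume) := by
    intro a b
    have h1 : (T (s a)).toLp 2 volume - (T (s b)).toLp 2 volume
        = (T (s a - s b)).toLp 2 volume := by
      simp only [map_sub, ← SchwartzMap.toLpCLM_apply (𝕜 := ℂ)]
    have h2 : (s a).toLp 2 volume - (s b).toLp 2 volume = (s a - s b).toLp 2 volume := by
      simp only [map_sub, ← SchwartzMap.toLpCLM_apply (𝕜 := ℂ)]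
    rw [dist_eq_norm, dist_eq_norm, h1, h2]
    refine (hT _).trans ?_
    gcongr
    linarith [le_abs_self C]
  rw [Metric.cauchySeq_iff]
  intro ε hε
  obtain ⟨n₀, hn₀⟩ := Metric.cauchySeq_iff.1 hs.cauchySeq (ε / (|C| + 1)) (by positivity)
  refine ⟨n₀, fun m hm n hn => (key m n).trans_lt ?_⟩
  have := hn₀ m hm n hn
  rwa [lt_div_iff₀' (by positivity)] at this

/-- The symbol of the Bessel potential of order `-2`. -/
noncomputable def besselSymbol (N : ℕ) (x : EuclideanSpace ℝ (Fin N)) : ℂ :=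
  (((1 + ‖x‖ ^ 2) ^ ((-2 : ℝ) / 2) : ℝ) : ℂ)

theorem besselSymbol_hasTemperateGrowth : (besselSymbol N).HasTemperateGrowth := by
  unfold besselSymbol; fun_prop

theorem norm_besselSymbol (x : 𝔼) : ‖besselSymbol N x‖ = (1 + ‖x‖ ^ 2)⁻¹ := by
  have h : (0 : ℝ) < 1 + ‖x‖ ^ 2 := by positivity
  rw [besselSymbol, Complex.norm_real, Real.norm_of_nonneg (by positivity), neg_div,
    div_self two_ne_zero, Real.rpow_neg_one]

theorem norm_toLp_lineDeriv_bessel_le (m : 𝔼) (f : 𝓢(𝔼, ℂ)) :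
    ‖(∂_{m} (SchwartzMap.fourierMultiplierCLM ℂ (besselSymbol N) f)).toLp 2 volume‖ ≤
      (2 * π * ‖m‖) * ‖f.toLp 2 volume‖ := by
  have h0 : ∂_{m} (SchwartzMap.fourierMultiplierCLM ℂ (besselSymbol N) f) =
      (2 * π * Complex.I) • SchwartzMap.fourierMultiplierCLM ℂ
        ((fun x : 𝔼 => ((inner ℝ x m : ℝ) : ℂ)) * besselSymbol N) f := by
    rw [SchwartzMap.lineDeriv_eq_fourierMultiplierCLM,
      ← SchwartzMap.fourierMultiplierCLM_fourierMultiplierCLM_apply (by fun_prop)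
        besselSymbol_hasTemperateGrowth,
      ← SchwartzMap.fourierMultiplierCLM_ofReal ℂ (by fun_prop)]
    rfl
  have h1 : ((2 * π * Complex.I) • SchwartzMap.fourierMultiplierCLM ℂ
        ((fun x : 𝔼 => ((inner ℝ x m : ℝ) : ℂ)) * besselSymbol N) f).toLp 2 volume =
      (2 * π * Complex.I) • (SchwartzMap.fourierMultiplierCLM ℂ
        ((fun x : 𝔼 => ((inner ℝ x m : ℝ) : ℂ)) * besselSymbol N) f).toLp 2 volume := by
    simp only [← SchwartzMap.toLpCLM_apply (𝕜 := ℂ), map_smul]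
  rw [h0, h1, norm_smul]
  have h2 : ‖(2 * π * Complex.I : ℂ)‖ = 2 * π := by
    simp [abs_of_pos Real.pi_pos]
  rw [h2, mul_assoc (2 * π) ‖m‖]
  refine mul_le_mul_of_nonneg_left ?_ (by positivity)
  refine norm_toLp_fourierMultiplierCLM_le
    (Function.HasTemperateGrowth.mul (by fun_prop) besselSymbol_hasTemperateGrowth) (fun x => ?_) f
  rw [Pi.mul_apply, norm_mul, norm_besselSymbol, Complex.norm_real, ← div_eq_mul_inv,
    div_le_iff₀ (by positivity)]
  refine (norm_inner_le_norm x m).trans ?_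
  nlinarith [norm_nonneg m, norm_nonneg x, sq_nonneg (‖x‖ - 1),
    mul_nonneg (norm_nonneg m) (sq_nonneg (‖x‖ - 1)), mul_nonneg (norm_nonneg m) (sq_nonneg ‖x‖)]

theorem norm_toLp_laplacian_bessel_le (f : 𝓢(𝔼, ℂ)) :
    ‖(Δ (SchwartzMap.fourierMultiplierCLM ℂ (besselSymbol N) f)).toLp 2 volume‖ ≤
      ((2 * π) ^ 2) * ‖f.toLp 2 volume‖ := by
  have h0 : Δ (SchwartzMap.fourierMultiplierCLM ℂ (besselSymbol N) f) =
      (-(2 * π) ^ 2 : ℝ) • SchwartzMap.fourierMultiplierCLM ℂ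
        ((fun x : 𝔼 => ((‖x‖ ^ 2 : ℝ) : ℂ)) * besselSymbol N) f := by
    rw [SchwartzMap.laplacian_eq_fourierMultiplierCLM,
      ← SchwartzMap.fourierMultiplierCLM_fourierMultiplierCLM_apply (by fun_prop)
        besselSymbol_hasTemperateGrowth,
      ← SchwartzMap.fourierMultiplierCLM_ofReal ℂ (by fun_prop)]
    rfl
  have h1 : ((-(2 * π) ^ 2 : ℝ) • SchwartzMap.fourierMultiplierCLM ℂ
        ((fun x : 𝔼 => ((‖x‖ ^ 2 : ℝ) : ℂ)) * besselSymbol N) f).toLp 2 volume =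
      (-(2 * π) ^ 2 : ℝ) • (SchwartzMap.fourierMultiplierCLM ℂ
        ((fun x : 𝔼 => ((‖x‖ ^ 2 : ℝ) : ℂ)) * besselSymbol N) f).toLp 2 volume := by
    simp only [← SchwartzMap.toLpCLM_apply (𝕜 := ℝ), map_smul]
  rw [h0, h1, norm_smul, norm_neg, Real.norm_of_nonneg (by positivity)]
  refine mul_le_mul_of_nonneg_left ?_ (by positivity)
  rw [← one_mul ‖f.toLp 2 volume‖]
  refine norm_toLp_fourierMultiplierCLM_le
    (Function.HasTemperateGrowth.mul (by fun_prop) besselSymbol_hasTemperateGrowth) (fun x => ?_) f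
  rw [Pi.mul_apply, norm_mul, norm_besselSymbol, Complex.norm_real,
    Real.norm_of_nonneg (by positivity), ← div_eq_mul_inv, div_le_iff₀ (by positivity)]
  linarith

/-- Every `u ∈ H²` is the limit of Schwartz functions which converge together with their first
derivatives and their Laplacians in `L²`. The limits of the first derivatives are the components
of the weak gradient of `u`. -/
theorem exists_schwartz_approximation (u : sobolevH2 N) :
    ∃ (v : ℕ → 𝓢(𝔼, ℂ)) (G : Fin N → Lp ℂ 2 (volume : Measure 𝔼)),
      Tendsto (fun n => (v n).toLp 2 volume) atTop
        (𝓝 (u : Lp ℂ 2 (volume : Measure 𝔼))) ∧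
      (∀ j, Tendsto (fun n => (∂_{EuclideanSpace.single j (1 : ℝ)} (v n)).toLp 2 volume) atTop
        (𝓝 (G j))) ∧
      Tendsto (fun n => (Δ (v n)).toLp 2 volume) atTop (𝓝 (laplacianH2 N u)) := by
  obtain ⟨f, hf⟩ : TemperedDistribution.MemSobolev 2 2
    ((u : Lp ℂ 2 (volume : Measure 𝔼)) : 𝓢'(𝔼, ℂ)) := u.2
  have hdense : f ∈ closure (range (SchwartzMap.toLpCLM ℝ ℂ 2 (volume : Measure 𝔼))) :=
    SchwartzMap.denseRange_toLpCLM ENNReal.ofNat_ne_top f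
  obtain ⟨w, hw, hwf⟩ := mem_closure_iff_seq_limit.1 hdense
  choose s hs using hw
  have hsf : Tendsto (fun n => (s n).toLp 2 volume) atTop (𝓝 f) := by
    refine hwf.congr fun n => ?_
    rw [← hs n, SchwartzMap.toLpCLM_apply]
  -- `u` is the Bessel potential of order `-2` of `f`; apply it to an approximation of `f`
  set T := SchwartzMap.fourierMultiplierCLM ℂ (besselSymbol N) with hT
  obtain ⟨V, hV⟩ := exists_tendsto_toLp (T := T) (C := 1)
    (norm_toLp_fourierMultiplierCLM_le besselSymbol_hasTemperateGrowth fun x => by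
      rw [norm_besselSymbol]
      exact inv_le_one_of_one_le₀ (by nlinarith [sq_nonneg ‖x‖])) hsf
  have hG : ∀ j : Fin N, ∃ w : Lp ℂ 2 (volume : Measure 𝔼), Tendsto
      (fun n => (∂_{EuclideanSpace.single j (1 : ℝ)} (T (s n))).toLp 2 volume) atTop (𝓝 w) :=
    fun j => exists_tendsto_toLp
      (T := (LineDeriv.lineDerivOpCLM ℂ 𝓢(𝔼, ℂ) (EuclideanSpace.single j (1 : ℝ))).comp T)
      (norm_toLp_lineDeriv_bessel_le _) hsf
  choose G hG using hG
  obtain ⟨W, hW⟩ := exists_tendsto_toLp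
      (T := (LineDeriv.laplacianCLM ℂ 𝔼 𝓢(𝔼, ℂ)).comp T) (C := (2 * π) ^ 2)
      (fun g => by
        have := norm_toLp_laplacian_bessel_le g
        rwa [ContinuousLinearMap.comp_apply, SchwartzMap.laplacianCLM_eq]) hsf
  set J := Lp.toTemperedDistributionCLM ℂ (volume : Measure 𝔼) 2 with hJ
  have hJs : ∀ g : 𝓢(𝔼, ℂ), J (g.toLp 2 volume) =
      SchwartzMap.toTemperedDistributionCLM 𝔼 ℂ volume g := fun g => by
    rw [hJ, Lp.toTemperedDistributionCLM_apply, Lp.toTemperedDistribution_toLp_eq]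
  have hVu : V = u := by
    apply toTemperedDistribution_injective_L2
    have h1 := (J.continuous.tendsto V).comp hV
    have h2 := ((TemperedDistribution.besselPotential 𝔼 ℂ (-2)).continuous.tendsto _).comp
      ((J.continuous.tendsto f).comp hsf)
    have h3 : TemperedDistribution.besselPotential 𝔼 ℂ (-2) (J f) = J u :=
      (TemperedDistribution.besselPotential_neg_apply_eq_iff 2 _ _).2 hf
    rw [← hJ, ← h3]
    refine tendsto_nhds_unique h1 (h2.congr fun n => ?_)
    simp only [Function.comp_apply, hJs]
    exact TemperedDistribution.fourierMultiplierCLM_toTemperedDistributionCLM_eq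
      besselSymbol_hasTemperateGrowth (s n)
  have hWu : W = laplacianH2 N u := by
    apply toTemperedDistribution_injective_L2
    have h1 := (J.continuous.tendsto W).comp hW
    have h2 := ((LineDeriv.laplacianCLM ℂ 𝔼 𝓢'(𝔼, ℂ)).continuous.tendsto _).comp
      ((J.continuous.tendsto V).comp hV)
    have h3 : J (laplacianH2 N u) = Δ (J V) := by
      rw [hVu]; exact (exists_laplacian_eq u).choose_spec.symm
    rw [← hJ, h3, ← TemperedDistribution.laplacianCLM_apply]
    refine tendsto_nhds_unique h1 (h2.congr fun n => ?_)
    simp only [Function.comp_apply, hJs, ContinuousLinearMap.comp_apply,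
      SchwartzMap.laplacianCLM_eq, TemperedDistribution.laplacianCLM_apply,
      TemperedDistribution.laplacian_toTemperedDistributionCLM_eq]
  refine ⟨fun n => T (s n), G, hVu ▸ hV, hG, hWu ▸ ?_⟩
  simpa only [ContinuousLinearMap.comp_apply, SchwartzMap.laplacianCLM_eq] using hW

end Approximation

/-! ### Weighted real inner products on `L²` -/

section WeightedInner

variable {N : ℕ}

local notation "𝔼" => EuclideanSpace ℝ (Fin N)
local notation "𝕃²" => Lp ℂ 2 (volume : Measure (EuclideanSpace ℝ (Fin N)))

/-- An essentially bounded measurable real weight. -/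
structure IsBddWeight (b : 𝔼 → ℝ) : Prop where
  meas : AEStronglyMeasurable b volume
  bdd : ∃ C : ℝ, ∀ᵐ x, |b x| ≤ C

namespace IsBddWeight

variable {a b : EuclideanSpace ℝ (Fin N) → ℝ}

theorem mul (ha : IsBddWeight a) (hb : IsBddWeight b) : IsBddWeight fun x => a x * b x := by
  obtain ⟨A, hA⟩ := ha.bdd
  obtain ⟨B, hB⟩ := hb.bdd
  refine ⟨ha.meas.mul hb.meas, A * B, ?_⟩
  filter_upwards [hA, hB] with x h1 h2
  rw [abs_mul]
  exact mul_le_mul h1 h2 (abs_nonneg _) ((abs_nonneg _).trans h1)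

theorem add (ha : IsBddWeight a) (hb : IsBddWeight b) : IsBddWeight fun x => a x + b x := by
  obtain ⟨A, hA⟩ := ha.bdd
  obtain ⟨B, hB⟩ := hb.bdd
  refine ⟨ha.meas.add hb.meas, A + B, ?_⟩
  filter_upwards [hA, hB] with x h1 h2
  exact (abs_add_le _ _).trans (add_le_add h1 h2)

theorem const (c : ℝ) : IsBddWeight fun _ : 𝔼 => c :=
  ⟨aestronglyMeasurable_const, |c|, Eventually.of_forall fun _ => le_rfl⟩

theorem sub (ha : IsBddWeight a) (hb : IsBddWeight b) : IsBddWeight fun x => a x - b x := by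
  simpa [sub_eq_add_neg] using ha.add ((const (-1)).mul hb)

end IsBddWeight

/-- The form `∫ b Re (f̄ g)` on `L²(ℝ^N; ℂ)`, for a bounded real weight `b`. -/
noncomputable def weightedInner (b : 𝔼 → ℝ) (f g : 𝕃²) : ℝ :=
  ∫ x, b x * inner ℝ (f x) (g x)

theorem integrable_inner_L2 (f g : 𝕃²) : Integrable fun x => inner ℝ (f x) (g x) :=
  memLp_one_iff_integrable.1
    ((innerSL ℝ (E := ℂ)).memLp_of_bilin 1 (Lp.memLp f) (Lp.memLp g))

theorem integrable_weightedInner {b : 𝔼 → ℝ} (hb : IsBddWeight b) (f g : 𝕃²) :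
    Integrable fun x => b x * inner ℝ (f x) (g x) := by
  obtain ⟨C, hC⟩ := hb.bdd
  exact (integrable_inner_L2 f g).bdd_mul hb.meas hC

/-- `weightedInner b` is a bounded bilinear form. -/
theorem exists_weightedInner_eq {b : 𝔼 → ℝ} (hb : IsBddWeight b) :
    ∃ (Λ : 𝕃² →L[ℝ] 𝕃² →L[ℝ] ℝ) (M : 𝕃² →L[ℝ] 𝕃²), ∀ f g, weightedInner b f g = Λ f (M g) := by
  obtain ⟨C, hC⟩ := hb.bdd
  have hb' : MemLp b ∞ volume := memLp_top_of_bound hb.meas C hC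
  refine ⟨(innerSL ℝ (E := ℂ)).lpPairing (volume : Measure 𝔼) 2 2,
    (ContinuousLinearMap.lsmul ℝ ℝ (E := ℂ)).holderL (volume : Measure 𝔼) ∞ 2 2 hb'.toLp,
    fun f g => ?_⟩
  rw [ContinuousLinearMap.lpPairing_eq_integral]
  refine integral_congr_ae ?_
  filter_upwards [(ContinuousLinearMap.lsmul ℝ ℝ (E := ℂ)).coeFn_holder (r := 2) hb'.toLp g,
    hb'.coeFn_toLp] with x hx1 hx2
  rw [ContinuousLinearMap.holderL_apply_apply, hx1, hx2, innerSL_apply_apply,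
    ContinuousLinearMap.lsmul_apply, inner_smul_right]

theorem tendsto_weightedInner {b : 𝔼 → ℝ} (hb : IsBddWeight b) {f g : ℕ → 𝕃²} {f₀ g₀ : 𝕃²}
    (hf : Tendsto f atTop (𝓝 f₀)) (hg : Tendsto g atTop (𝓝 g₀)) :
    Tendsto (fun n => weightedInner b (f n) (g n)) atTop (𝓝 (weightedInner b f₀ g₀)) := by
  obtain ⟨Λ, M, key⟩ := exists_weightedInner_eq hb
  simp only [key]
  have h2 : Tendsto (fun n => M (g n)) atTop (𝓝 (M g₀)) := (M.continuous.tendsto g₀).comp hg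
  exact (Λ.continuous₂.tendsto (f₀, M g₀)).comp (hf.prodMk_nhds h2)

/-- Dominated convergence in the weight. -/
theorem tendsto_weightedInner_weight {b : ℕ → 𝔼 → ℝ} {b₀ : 𝔼 → ℝ} {C : ℝ}
    (hm : ∀ n, AEStronglyMeasurable (b n) volume) (hC : ∀ n, ∀ᵐ x, |b n x| ≤ C)
    (hb : ∀ᵐ x, Tendsto (fun n => b n x) atTop (𝓝 (b₀ x))) (f g : 𝕃²) :
    Tendsto (fun n => weightedInner (b n) f g) atTop (𝓝 (weightedInner b₀ f g)) := by
  refine tendsto_integral_of_dominated_convergence (fun x => C * ‖inner ℝ (f x) (g x)‖)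
    (fun n => (hm n).mul (integrable_inner_L2 f g).1) ((integrable_inner_L2 f g).norm.const_mul C)
    (fun n => ?_) ?_
  · filter_upwards [hC n] with x hx
    rw [norm_mul]
    exact mul_le_mul_of_nonneg_right hx (norm_nonneg _)
  · filter_upwards [hb] with x hx
    exact hx.mul_const _

theorem weightedInner_comm (b : 𝔼 → ℝ) (f g : 𝕃²) :
    weightedInner b f g = weightedInner b g f := by
  simp only [weightedInner, real_inner_comm]

theorem weightedInner_sub {a b : 𝔼 → ℝ} (ha : IsBddWeight a) (hb : IsBddWeight b) (f g : 𝕃²) :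
    weightedInner (fun x => a x - b x) f g = weightedInner a f g - weightedInner b f g := by
  simp only [weightedInner, sub_mul]
  exact integral_sub (integrable_weightedInner ha f g) (integrable_weightedInner hb f g)

theorem weightedInner_const_mul (c : ℝ) (b : 𝔼 → ℝ) (f g : 𝕃²) :
    weightedInner (fun x => c * b x) f g = c * weightedInner b f g := by
  simp only [weightedInner, mul_assoc]
  exact integral_const_mul c _

theorem weightedInner_congr {b b' : 𝔼 → ℝ} {f g f' g' : 𝕃²}
    (h : ∀ᵐ x, b x * inner ℝ (f x) (g x) = b' x * inner ℝ (f' x) (g' x)) :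
    weightedInner b f g = weightedInner b' f' g' :=
  integral_congr_ae h

theorem weightedInner_self_nonneg {b : 𝔼 → ℝ} (hb : ∀ᵐ x, 0 ≤ b x) (f : 𝕃²) :
    0 ≤ weightedInner b f f := by
  refine integral_nonneg_of_ae ?_
  filter_upwards [hb] with x hx
  exact mul_nonneg hx real_inner_self_nonneg

theorem eq_zero_of_weightedInner_self_le {b : 𝔼 → ℝ} (hb : IsBddWeight b)
    (hpos : ∀ᵐ x, 0 < b x) {f : 𝕃²} (h : weightedInner b f f ≤ 0) : f = 0 := by
  have h0 : weightedInner b f f = 0 :=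
    le_antisymm h (weightedInner_self_nonneg (hpos.mono fun x hx => hx.le) f)
  have h1 : 0 ≤ᵐ[volume] fun x => b x * inner ℝ (f x) (f x) := by
    filter_upwards [hpos] with x hx
    exact mul_nonneg hx.le real_inner_self_nonneg
  have h2 := (integral_eq_zero_iff_of_nonneg_ae h1 (integrable_weightedInner hb f f)).1 h0
  rw [Lp.eq_zero_iff_ae_eq_zero]
  filter_upwards [h2, hpos] with x hx hp
  simpa [hp.ne'] using hx

theorem sum_weightedInner {b : Fin N → 𝔼 → ℝ} (hb : ∀ k, IsBddWeight (b k))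
    (f g : Fin N → 𝕃²) :
    ∑ k, weightedInner (b k) (f k) (g k) = ∫ x, ∑ k, b k x * inner ℝ (f k x) (g k x) :=
  (integral_finsetSum _ fun k _ => integrable_weightedInner (hb k) (f k) (g k)).symm

theorem integrable_sum_weightedInner {b : Fin N → 𝔼 → ℝ} (hb : ∀ k, IsBddWeight (b k))
    (f g : Fin N → 𝕃²) : Integrable fun x => ∑ k, b k x * inner ℝ (f k x) (g k x) :=
  integrable_finsetSum _ fun k _ => integrable_weightedInner (hb k) (f k) (g k)

theorem weightedInner_toLp (b : 𝔼 → ℝ) (v w : 𝓢(𝔼, ℂ)) :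
    weightedInner b (v.toLp 2 volume) (w.toLp 2 volume) = ∫ x, b x * inner ℝ (v x) (w x) := by
  refine integral_congr_ae ?_
  filter_upwards [v.coeFn_toLp 2 volume, w.coeFn_toLp 2 volume] with x h1 h2
  rw [h1, h2]

/-- A bounded `C¹` weight with bounded first derivatives; these are the weights by which the
integral identities may be multiplied without leaving `L²`. -/
structure IsC1Weight (φ : 𝔼 → ℝ) : Prop where
  contDiff : ContDiff ℝ 1 φ
  bdd : ∃ C : ℝ, ∀ x, |φ x| ≤ C
  bdd_fderiv : ∃ C : ℝ, ∀ x, ‖fderiv ℝ φ x‖ ≤ C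

namespace IsC1Weight

variable {φ ψ : EuclideanSpace ℝ (Fin N) → ℝ}

theorem differentiable (h : IsC1Weight φ) : Differentiable ℝ φ :=
  h.contDiff.differentiable one_ne_zero

theorem isBddWeight (h : IsC1Weight φ) : IsBddWeight φ :=
  ⟨h.contDiff.continuous.aestronglyMeasurable, h.bdd.imp fun _ hC => Eventually.of_forall hC⟩

theorem continuous_fderiv (h : IsC1Weight φ) (e : 𝔼) : Continuous fun x => fderiv ℝ φ x e :=
  (h.contDiff.continuous_fderiv one_ne_zero).clm_apply continuous_const

theorem isBddWeight_fderiv (h : IsC1Weight φ) (e : 𝔼) : IsBddWeight fun x => fderiv ℝ φ x e := by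
  obtain ⟨C, hC⟩ := h.bdd_fderiv
  refine ⟨(h.continuous_fderiv e).aestronglyMeasurable, C * ‖e‖, Eventually.of_forall fun x => ?_⟩
  exact (ContinuousLinearMap.le_opNorm _ e).trans (mul_le_mul_of_nonneg_right (hC x) (norm_nonneg e))

theorem mul (h : IsC1Weight φ) (h' : IsC1Weight ψ) : IsC1Weight fun x => φ x * ψ x := by
  obtain ⟨A, hA⟩ := h.bdd
  obtain ⟨A', hA'⟩ := h.bdd_fderiv
  obtain ⟨B, hB⟩ := h'.bdd
  obtain ⟨B', hB'⟩ := h'.bdd_fderiv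
  refine ⟨h.contDiff.mul h'.contDiff, ⟨A * B, fun x => ?_⟩, ⟨A * B' + B * A', fun x => ?_⟩⟩
  · rw [abs_mul]
    exact mul_le_mul (hA x) (hB x) (abs_nonneg _) ((abs_nonneg _).trans (hA x))
  · rw [fderiv_fun_mul (h.differentiable x) (h'.differentiable x)]
    refine (norm_add_le _ _).trans ?_
    rw [norm_smul, norm_smul]
    exact add_le_add
      (mul_le_mul (hA x) (hB' x) (norm_nonneg _) ((abs_nonneg _).trans (hA x)))
      (mul_le_mul (hB x) (hA' x) (norm_nonneg _) ((abs_nonneg _).trans (hB x)))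

theorem const (c : ℝ) : IsC1Weight fun _ : 𝔼 => c :=
  ⟨contDiff_const, ⟨|c|, fun _ => le_rfl⟩, ⟨0, fun x => by simp⟩⟩

theorem sub (h : IsC1Weight φ) (h' : IsC1Weight ψ) : IsC1Weight fun x => φ x - ψ x := by
  obtain ⟨A, hA⟩ := h.bdd
  obtain ⟨A', hA'⟩ := h.bdd_fderiv
  obtain ⟨B, hB⟩ := h'.bdd
  obtain ⟨B', hB'⟩ := h'.bdd_fderiv
  refine ⟨h.contDiff.sub h'.contDiff, ⟨A + B, fun x => ?_⟩, ⟨A' + B', fun x => ?_⟩⟩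
  · exact (abs_sub _ _).trans (add_le_add (hA x) (hB x))
  · rw [fderiv_fun_sub (h.differentiable x) (h'.differentiable x)]
    exact (norm_sub_le _ _).trans (add_le_add (hA' x) (hB' x))

theorem of_hasCompactSupport (h : ContDiff ℝ 1 φ) (hs : HasCompactSupport φ) : IsC1Weight φ :=
  ⟨h, hs.exists_bound_of_continuous h.continuous,
    (hs.fderiv (𝕜 := ℝ)).exists_bound_of_continuous (h.continuous_fderiv one_ne_zero)⟩

end IsC1Weight

/-! ### Integration by parts for Schwartz functions -/

theorem SchwartzMap.lineDerivOp_comm (v : 𝓢(𝔼, ℂ)) (m m' : 𝔼) :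
    ∂_{m} (∂_{m'} v) = ∂_{m'} (∂_{m} v) := by
  simp only [SchwartzMap.lineDeriv_eq_fourierMultiplierCLM,
    ← SchwartzMap.fourierMultiplierCLM_ofReal ℂ
      (show Function.HasTemperateGrowth fun x : 𝔼 => inner ℝ x m by fun_prop),
    ← SchwartzMap.fourierMultiplierCLM_ofReal ℂ
      (show Function.HasTemperateGrowth fun x : 𝔼 => inner ℝ x m' by fun_prop), map_smul]
  rw [SchwartzMap.fourierMultiplierCLM_fourierMultiplierCLM_apply (by fun_prop) (by fun_prop),
    SchwartzMap.fourierMultiplierCLM_fourierMultiplierCLM_apply (by fun_prop) (by fun_prop)]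
  congr 4
  exact funext fun x => mul_comm _ _

theorem integrable_weight_inner_schwartz {b : 𝔼 → ℝ} (hb : IsBddWeight b) (v w : 𝓢(𝔼, ℂ)) :
    Integrable fun x => b x * inner ℝ (v x) (w x) := by
  have := integrable_weightedInner hb (v.toLp 2 volume) (w.toLp 2 volume)
  refine this.congr ?_
  filter_upwards [v.coeFn_toLp 2 volume, w.coeFn_toLp 2 volume] with x h1 h2
  rw [h1, h2]

/-- Integration by parts: the integral of the derivative of `φ Re (v̄ w)` in direction `e`
vanishes. -/
theorem weightedInner_fderiv_add {φ : 𝔼 → ℝ} (hφ : IsC1Weight φ) (e : 𝔼) (v w : 𝓢(𝔼, ℂ)) :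
    weightedInner (fun x => fderiv ℝ φ x e) (v.toLp 2 volume) (w.toLp 2 volume) +
      weightedInner φ ((∂_{e} v).toLp 2 volume) (w.toLp 2 volume) +
      weightedInner φ (v.toLp 2 volume) ((∂_{e} w).toLp 2 volume) = 0 := by
  simp only [weightedInner_toLp]
  have hd : ∀ x, HasFDerivAt (fun x => inner ℝ (v x) (w x)) _ x :=
    fun x => (v.hasFDerivAt x).inner ℝ (w.hasFDerivAt x)
  have hde : ∀ x, fderiv ℝ (fun x => (inner ℝ (v x) (w x) : ℝ)) x e =
      inner ℝ ((∂_{e} v) x) (w x) + inner ℝ (v x) ((∂_{e} w) x) := by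
    intro x
    rw [(hd x).fderiv]
    simp [SchwartzMap.lineDerivOp_apply_eq_fderiv, add_comm]
  have i1 := integrable_weight_inner_schwartz (hφ.isBddWeight_fderiv e) v w
  have i2 := integrable_weight_inner_schwartz hφ.isBddWeight (∂_{e} v) w
  have i3 := integrable_weight_inner_schwartz hφ.isBddWeight v (∂_{e} w)
  have h := integral_mul_fderiv_eq_neg_fderiv_mul_of_integrable (μ := volume) (f := φ)
    (g := fun x => (inner ℝ (v x) (w x) : ℝ)) (v := e) i1
    (by simp only [hde, mul_add]; exact i2.add i3)
    (integrable_weight_inner_schwartz hφ.isBddWeight v w)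
    (fun x _ => hφ.differentiable x) (fun x _ => (hd x).differentiableAt)
  simp only [hde, mul_add] at h
  rw [integral_add i2 i3] at h
  linarith

end WeightedInner

/-! ### Integral identities for `H²` functions -/

section Identities

variable {N : ℕ}

local notation "𝔼" => EuclideanSpace ℝ (Fin N)
local notation "𝕃²" => Lp ℂ 2 (volume : Measure (EuclideanSpace ℝ (Fin N)))
local notation "𝖾" j:max => (EuclideanSpace.single j (1 : ℝ) : EuclideanSpace ℝ (Fin N))

/-- `u` is an `H²` function with weak gradient `G` and Laplacian `W`, in the form in which this is
used: the triple is an `L²` limit of the corresponding triples of Schwartz functions. -/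
def HasGradientLaplacian (u : 𝕃²) (G : Fin N → 𝕃²) (W : 𝕃²) : Prop :=
  ∃ v : ℕ → 𝓢(𝔼, ℂ),
    Tendsto (fun n => (v n).toLp 2 volume) atTop (𝓝 u) ∧
    (∀ j, Tendsto (fun n => (∂_{𝖾 j} (v n)).toLp 2 volume) atTop (𝓝 (G j))) ∧
    Tendsto (fun n => (Δ (v n)).toLp 2 volume) atTop (𝓝 W)

theorem exists_hasGradientLaplacian (u : sobolevH2 N) :
    ∃ G : Fin N → 𝕃², HasGradientLaplacian (u : 𝕃²) G (laplacianH2 N u) := by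
  obtain ⟨v, G, h⟩ := exists_schwartz_approximation u
  exact ⟨G, v, h⟩

theorem toLp_laplacian (v : 𝓢(𝔼, ℂ)) :
    (Δ v).toLp 2 volume = ∑ j, (∂_{𝖾 j} (∂_{𝖾 j} v)).toLp 2 (volume : Measure 𝔼) := by
  have h := SchwartzMap.laplacian_eq_sum (EuclideanSpace.basisFun (Fin N) ℝ) v
  simp only [EuclideanSpace.basisFun_apply] at h
  rw [h]
  simp only [← SchwartzMap.toLpCLM_apply (𝕜 := ℂ), map_sum]

theorem weightedInner_sum_left {b : 𝔼 → ℝ} (hb : IsBddWeight b) (f : Fin N → 𝕃²) (g : 𝕃²) :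
    weightedInner b (∑ j, f j) g = ∑ j, weightedInner b (f j) g := by
  obtain ⟨Λ, M, key⟩ := exists_weightedInner_eq hb
  simp [key]

theorem weightedInner_sum_right {b : 𝔼 → ℝ} (hb : IsBddWeight b) (f : 𝕃²) (g : Fin N → 𝕃²) :
    weightedInner b f (∑ j, g j) = ∑ j, weightedInner b f (g j) := by
  obtain ⟨Λ, M, key⟩ := exists_weightedInner_eq hb
  simp [key]

theorem weightedInner_I_smul_self (f : 𝕃²) : weightedInner (fun _ => 1) (Complex.I • f) f = 0 := by
  rw [weightedInner]
  refine integral_eq_zero_of_ae ?_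
  filter_upwards [Lp.coeFn_smul Complex.I f] with x hx
  rw [hx]
  simp [Complex.inner, mul_comm]

namespace HasGradientLaplacian

variable {u W : Lp ℂ 2 (volume : Measure (EuclideanSpace ℝ (Fin N)))}
  {G : Fin N → Lp ℂ 2 (volume : Measure (EuclideanSpace ℝ (Fin N)))}

/-- Green's formula: `∫ φ Re(ū Δu) + ∫ φ |∇u|² + ∫ Re(ū ∇φ·∇u) = 0`. -/
theorem green (h : HasGradientLaplacian u G W) {φ : 𝔼 → ℝ} (hφ : IsC1Weight φ) :
    weightedInner φ u W + ∑ j, weightedInner φ (G j) (G j) +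
      ∑ j, weightedInner (fun x => fderiv ℝ φ x (𝖾 j)) u (G j) = 0 := by
  obtain ⟨v, hu, hG, hW⟩ := h
  have h1 := tendsto_weightedInner hφ.isBddWeight hu hW
  have h2 := tendsto_finsetSum Finset.univ fun j _ =>
    tendsto_weightedInner hφ.isBddWeight (hG j) (hG j)
  have h3 := tendsto_finsetSum Finset.univ fun j _ =>
    tendsto_weightedInner (hφ.isBddWeight_fderiv (𝖾 j)) hu (hG j)
  refine tendsto_nhds_unique ((h1.add h2).add h3) (tendsto_const_nhds.congr fun n => ?_)
  rw [toLp_laplacian, weightedInner_sum_right hφ.isBddWeight, ← Finset.sum_add_distrib,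
    ← Finset.sum_add_distrib]
  refine (Finset.sum_eq_zero fun j _ => ?_).symm
  have := weightedInner_fderiv_add hφ (𝖾 j) (v n) (∂_{𝖾 j} (v n))
  linarith

/-- `∫ ū Δu` is real. -/
theorem weightedInner_I_smul (h : HasGradientLaplacian u G W) :
    weightedInner (fun _ => 1) (Complex.I • u) W = 0 := by
  obtain ⟨v, hu, hG, hW⟩ := h
  have h1 := tendsto_weightedInner (IsBddWeight.const 1) (hu.const_smul Complex.I) hW
  refine tendsto_nhds_unique h1 (tendsto_const_nhds.congr fun n => ?_)
  have hI : ∀ w : 𝓢(𝔼, ℂ), Complex.I • w.toLp 2 (volume : Measure 𝔼)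
      = (Complex.I • w).toLp 2 volume := fun w => by
    simp only [← SchwartzMap.toLpCLM_apply (𝕜 := ℂ), map_smul]
  rw [toLp_laplacian, weightedInner_sum_right (IsBddWeight.const 1)]
  refine (Finset.sum_eq_zero fun j _ => ?_).symm
  have h2 := weightedInner_fderiv_add (IsC1Weight.const 1) (𝖾 j) (Complex.I • v n)
    (∂_{𝖾 j} (v n))
  have h3 : ∂_{𝖾 j} (Complex.I • v n) = Complex.I • ∂_{𝖾 j} (v n) :=
    map_smul (LineDeriv.lineDerivOpCLM ℂ 𝓢(𝔼, ℂ) (𝖾 j)) Complex.I (v n)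
  rw [h3, ← hI, ← hI, weightedInner_I_smul_self] at h2
  have h4 : weightedInner (fun x : 𝔼 => fderiv ℝ (fun _ : 𝔼 => (1 : ℝ)) x (𝖾 j))
      (Complex.I • (v n).toLp 2 volume) ((∂_{𝖾 j} (v n)).toLp 2 volume) = 0 := by
    simp [weightedInner]
  rw [h4] at h2
  linarith

/-- `∫ W_k ∂_k |u|² = - ∫ (∂_k W_k) |u|²`. -/
theorem integral_fderiv_normSq (h : HasGradientLaplacian u G W) {φ : 𝔼 → ℝ} (hφ : IsC1Weight φ)
    (k : Fin N) :
    weightedInner (fun x => fderiv ℝ φ x (𝖾 k)) u u + 2 * weightedInner φ u (G k) = 0 := by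
  obtain ⟨v, hu, hG, hW⟩ := h
  have h1 := tendsto_weightedInner (hφ.isBddWeight_fderiv (𝖾 k)) hu hu
  have h2 := (tendsto_weightedInner hφ.isBddWeight hu (hG k)).const_mul 2
  refine tendsto_nhds_unique (h1.add h2) (tendsto_const_nhds.congr fun n => ?_)
  have := weightedInner_fderiv_add hφ (𝖾 k) (v n) (v n)
  rw [weightedInner_comm φ ((∂_{𝖾 k} (v n) : 𝓢(𝔼, ℂ)).toLp 2 volume)] at this
  linarith

/-- The virial (Rellich-Pohozaev) identity for a vector field `V`:
`2 ∫ Re (Δu V·∇ū) = ∫ (div V) |∇u|² - 2 ∫ ∂_j V_k Re (∂_j u ∂_k ū)`. -/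
theorem virial (h : HasGradientLaplacian u G W) {V : Fin N → 𝔼 → ℝ} (hV : ∀ k, IsC1Weight (V k)) :
    2 * ∑ k, weightedInner (V k) W (G k) =
      ∑ k, ∑ j, weightedInner (fun x => fderiv ℝ (V k) x (𝖾 k)) (G j) (G j) -
      2 * ∑ k, ∑ j, weightedInner (fun x => fderiv ℝ (V k) x (𝖾 j)) (G j) (G k) := by
  obtain ⟨v, hu, hG, hW⟩ := h
  have h1 := (tendsto_finsetSum Finset.univ fun k _ =>
    tendsto_weightedInner (hV k).isBddWeight hW (hG k)).const_mul 2
  have h2 := tendsto_finsetSum Finset.univ fun k _ => tendsto_finsetSum Finset.univ fun j _ =>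
    tendsto_weightedInner ((hV k).isBddWeight_fderiv (𝖾 k)) (hG j) (hG j)
  have h3 := (tendsto_finsetSum Finset.univ fun k _ => tendsto_finsetSum Finset.univ fun j _ =>
    tendsto_weightedInner ((hV k).isBddWeight_fderiv (𝖾 j)) (hG j) (hG k)).const_mul 2
  refine tendsto_nhds_unique h1 ((h2.sub h3).congr fun n => ?_)
  rw [Finset.mul_sum, Finset.mul_sum, ← Finset.sum_sub_distrib]
  refine Finset.sum_congr rfl fun k _ => ?_
  rw [toLp_laplacian, weightedInner_sum_left (hV k).isBddWeight, Finset.mul_sum, Finset.mul_sum,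
    ← Finset.sum_sub_distrib]
  refine Finset.sum_congr rfl fun j _ => ?_
  have e1 := weightedInner_fderiv_add (hV k) (𝖾 j) (∂_{𝖾 j} (v n)) (∂_{𝖾 k} (v n))
  have e2 := weightedInner_fderiv_add (hV k) (𝖾 k) (∂_{𝖾 j} (v n)) (∂_{𝖾 j} (v n))
  rw [weightedInner_comm (V k) ((∂_{𝖾 k} (∂_{𝖾 j} (v n) : 𝓢(𝔼, ℂ)) : 𝓢(𝔼, ℂ)).toLp 2 volume)] at e2
  rw [SchwartzMap.lineDerivOp_comm (v n) (𝖾 j) (𝖾 k)] at e1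
  linarith

end HasGradientLaplacian

/-! ### Coefficients that are monotone along rays -/

/-- If `r ↦ r ^ α m (r x)` is nondecreasing for almost every `x`, then the distribution
`x·∇m + α m` is nonnegative: here `p + α = N`, and `p ψ + x·∇ψ = div (x ψ) - α ψ`. The inequality
is the derivative at `r = 1` of the dilated integrals `∫ m(y) r ^ p ψ (r y) dy`. -/
theorem integral_mul_div_nonpos {m : 𝔼 → ℝ} (hm : IsBddWeight m) {α p : ℕ} (hαp : p + α = N)
    (hmono : ∀ s : ℝ, 1 < s → ∀ᵐ x, m x ≤ s ^ α * m (s • x)) {ψ : 𝔼 → ℝ}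
    (hψ : ContDiff ℝ 1 ψ) (hsupp : HasCompactSupport ψ) (hψ0 : ∀ x, 0 ≤ ψ x) :
    ∫ x, m x * (p * ψ x + fderiv ℝ ψ x x) ≤ 0 := by
  obtain ⟨C, hC⟩ := hm.bdd
  obtain ⟨B, hB⟩ := hsupp.exists_bound_of_continuous hψ.continuous
  obtain ⟨B', hB'⟩ := (hsupp.fderiv (𝕜 := ℝ)).exists_bound_of_continuous
    (hψ.continuous_fderiv one_ne_zero)
  obtain ⟨R, hR0, hR⟩ : ∃ R : ℝ, 0 < R ∧ tsupport ψ ⊆ Metric.closedBall 0 R := by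
    obtain ⟨R, hR⟩ := hsupp.isBounded.subset_closedBall 0
    exact ⟨max R 1, by positivity, hR.trans (Metric.closedBall_subset_closedBall (le_max_left _ _))⟩
  set F : ℝ → 𝔼 → ℝ := fun r y => m y * (r ^ p * ψ (r • y)) with hF
  set F' : ℝ → 𝔼 → ℝ := fun r y =>
    m y * (p * r ^ (p - 1) * ψ (r • y) + r ^ p * fderiv ℝ ψ (r • y) y) with hF'
  have hout : ∀ z : 𝔼, R < ‖z‖ → ψ z = 0 ∧ fderiv ℝ ψ z = 0 := by
    intro z hz
    have hz' : z ∉ tsupport ψ := fun h => by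
      have := hR h
      rw [mem_closedBall_zero_iff] at this
      linarith
    exact ⟨image_eq_zero_of_notMem_tsupport hz', by
      by_contra hne
      exact hz' (support_fderiv_subset ℝ hne)⟩
  have hcontF : ∀ r : ℝ, Continuous fun y : 𝔼 => r ^ p * ψ (r • y) := fun r =>
    continuous_const.mul (hψ.continuous.comp (continuous_const_smul r))
  have hint : ∀ r : ℝ, 0 < r → Integrable (F r) := by
    intro r hr
    have hcs : HasCompactSupport fun y : 𝔼 => r ^ p * ψ (r • y) :=
      (hsupp.comp_smul hr.ne').mul_left
    exact ((hcontF r).integrable_of_hasCompactSupport hcs).bdd_mul hm.meas hC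
  -- the derivative of the dilated integrals at `r = 1`
  have hder : HasDerivAt (fun r => ∫ y, F r y) (∫ y, F' 1 y) 1 := by
    refine (hasDerivAt_integral_of_dominated_loc_of_deriv_le (F := F) (F' := F')
      (bound := (Metric.closedBall (0 : 𝔼) (2 * R)).indicator fun _ =>
        |C| * (p * 2 ^ (p - 1) * B + 2 ^ p * (B' * (2 * R))))
      (Ioo_mem_nhds (show (1 / 2 : ℝ) < 1 by norm_num) (show (1 : ℝ) < 2 by norm_num))
      (Eventually.of_forall fun r => hm.meas.mul (hcontF r).aestronglyMeasurable)
      (hint 1 one_pos) ?_ ?_ ?_ ?_).2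
    · refine hm.meas.mul (Continuous.aestronglyMeasurable ?_)
      have h1 : Continuous fun y : 𝔼 => fderiv ℝ ψ ((1 : ℝ) • y) y :=
        ((hψ.continuous_fderiv one_ne_zero).comp (continuous_const_smul _)).clm_apply continuous_id
      have h2 : Continuous fun y : 𝔼 => ψ ((1 : ℝ) • y) :=
        hψ.continuous.comp (continuous_const_smul _)
      fun_prop
    · filter_upwards [hC] with y hy r hr
      have hr0 : 0 < r := by linarith [hr.1]
      by_cases hyR : y ∈ Metric.closedBall (0 : 𝔼) (2 * R)
      · rw [indicator_of_mem hyR, hF', norm_mul]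
        rw [mem_closedBall_zero_iff] at hyR
        have hB0 : 0 ≤ B := (norm_nonneg _).trans (hB 0)
        have hB0' : 0 ≤ B' := (norm_nonneg _).trans (hB' 0)
        refine mul_le_mul (hy.trans (le_abs_self C)) ?_ (norm_nonneg _) (abs_nonneg _)
        refine (norm_add_le _ _).trans (add_le_add ?_ ?_)
        · rw [norm_mul, Real.norm_of_nonneg (by positivity)]
          gcongr
          · exact hr.2.le
          · exact hB _
        · rw [norm_mul, Real.norm_of_nonneg (by positivity)]
          gcongr
          · exact hr.2.le
          · exact (ContinuousLinearMap.le_opNorm _ _).trans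
              (mul_le_mul (hB' _) hyR (norm_nonneg _) hB0')
      · rw [indicator_of_notMem hyR]
        rw [mem_closedBall_zero_iff, not_le] at hyR
        have hry : R < ‖r • y‖ := by
          rw [norm_smul, Real.norm_of_nonneg hr0.le]
          nlinarith [hr.1]
        simp [hF', hout _ hry]
    · rw [integrable_indicator_iff Metric.isClosed_closedBall.measurableSet]
      exact integrableOn_const measure_closedBall_lt_top.ne
    · refine Eventually.of_forall fun y r _ => ?_
      have h1 : HasDerivAt (fun r : ℝ => ψ (r • y)) (fderiv ℝ ψ (r • y) y) r := by
        have h2 : HasDerivAt (fun r : ℝ => r • y) y r := by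
          simpa using (hasDerivAt_id r).smul_const y
        exact ((hψ.differentiable one_ne_zero) _).hasFDerivAt.comp_hasDerivAt r h2
      exact ((hasDerivAt_pow p r).mul h1).const_mul (m y)
  -- a dilated integral with `r < 1` is at least the one with `r = 1`
  have hge : ∀ r ∈ Ioo (0 : ℝ) 1, ∫ y, F 1 y ≤ ∫ y, F r y := by
    intro r hr
    have hs : 1 < r⁻¹ := (one_lt_inv₀ hr.1).2 hr.2
    have hscale := Measure.integral_comp_smul (volume : Measure 𝔼)
      (fun y => (r⁻¹) ^ α * (m y * ψ (r • y))) r⁻¹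
    rw [finrank_euclideanSpace_fin, smul_eq_mul, abs_of_pos (by have := hr.1; positivity)]
      at hscale
    have e1 : ∫ y, F r y = ∫ x, (r⁻¹) ^ α * (m (r⁻¹ • x) * ψ (r • r⁻¹ • x)) := by
      rw [hscale, ← integral_const_mul]
      congr 1
      ext y
      have hr0 : r ≠ 0 := hr.1.ne'
      simp only [hF]
      have hpow : r ^ N = r ^ p * r ^ α := by rw [← pow_add, hαp]
      rw [inv_pow, inv_pow, inv_inv, hpow]
      field_simp
    rw [e1]
    have i1 : Integrable fun x => (r⁻¹) ^ α * (m (r⁻¹ • x) * ψ (r • r⁻¹ • x)) := by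
      have i2 : Integrable fun y => (r⁻¹) ^ α * (m y * ψ (r • y)) := by
        refine ((hint r hr.1).const_mul ((r⁻¹) ^ α * (r ^ p)⁻¹)).congr
          (Eventually.of_forall fun y => ?_)
        have hr0 : r ≠ 0 := hr.1.ne'
        simp only [hF]
        field_simp
      exact i2.comp_smul (inv_ne_zero hr.1.ne')
    refine integral_mono_ae (hint 1 one_pos) i1 ?_
    filter_upwards [hmono r⁻¹ hs] with x hx
    simp only [hF, one_pow, one_mul, one_smul]
    rw [smul_smul, mul_inv_cancel₀ hr.1.ne', one_smul, ← mul_assoc]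
    exact mul_le_mul_of_nonneg_right hx (hψ0 x)
  have hfin : ∫ y, F' 1 y = ∫ x, m x * (p * ψ x + fderiv ℝ ψ x x) := by
    simp [hF']
  rw [← hfin]
  have hslope := (hasDerivAt_iff_tendsto_slope_left_right.1 hder).1
  refine le_of_tendsto hslope ?_
  filter_upwards [Ioo_mem_nhdsLT (zero_lt_one (α := ℝ))] with r hr
  rw [slope_def_field]
  exact div_nonpos_of_nonneg_of_nonpos (by linarith [hge r hr]) (by linarith [hr.2])

/-- The inequality of `integral_mul_div_nonpos` for `ψ = χ |u|²`. -/
theorem HasGradientLaplacian.monotone_weight {u W : 𝕃²} {G : Fin N → 𝕃²}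
    (h : HasGradientLaplacian u G W) {m : 𝔼 → ℝ} (hm : IsBddWeight m) {α p : ℕ}
    (hαp : p + α = N) (hmono : ∀ s : ℝ, 1 < s → ∀ᵐ x, m x ≤ s ^ α * m (s • x)) {χ : 𝔼 → ℝ}
    (hχ : ContDiff ℝ 1 χ) (hsupp : HasCompactSupport χ) (hχ0 : ∀ x, 0 ≤ χ x)
    (hχr : IsBddWeight fun x => fderiv ℝ χ x x) (hχx : ∀ k, IsC1Weight fun x : 𝔼 => χ x * x k) :
    weightedInner (fun x => m x * (p * χ x + fderiv ℝ χ x x)) u u +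
      2 * ∑ k, weightedInner (fun x => m x * (χ x * x k)) u (G k) ≤ 0 := by
  obtain ⟨v, hu, hG, hW⟩ := h
  have hχ1 := IsC1Weight.of_hasCompactSupport hχ hsupp
  have hb1 : IsBddWeight fun x => m x * (p * χ x + fderiv ℝ χ x x) :=
    hm.mul (((IsBddWeight.const (p : ℝ)).mul hχ1.isBddWeight).add hχr)
  have hb2 : ∀ k, IsBddWeight fun x : 𝔼 => m x * (χ x * x k) := fun k =>
    hm.mul (hχx k).isBddWeight
  have h1 := tendsto_weightedInner hb1 hu hu
  have h2 := (tendsto_finsetSum Finset.univ fun k _ =>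
    tendsto_weightedInner (hb2 k) hu (hG k)).const_mul 2
  refine le_of_tendsto' (h1.add h2) fun n => ?_
  have key := integral_mul_div_nonpos hm hαp hmono (ψ := fun x => χ x * ‖v n x‖ ^ 2)
    (hχ.mul (((v n).smooth 1).norm_sq ℝ)) hsupp.mul_right
    fun x => mul_nonneg (hχ0 x) (sq_nonneg _)
  refine le_trans (le_of_eq ?_) key
  have hcoord : ∀ x : 𝔼, fderiv ℝ (v n) x x = ∑ k, (x k : ℝ) • (∂_{𝖾 k} (v n)) x := by
    intro x
    simp only [SchwartzMap.lineDerivOp_apply_eq_fderiv]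
    conv_lhs => rw [show fderiv ℝ (v n) x x = fderiv ℝ (v n) x (∑ k, x k • 𝖾 k) by
      congr 1
      have := (EuclideanSpace.basisFun (Fin N) ℝ).sum_repr x
      simpa using this.symm]
    simp only [map_sum, map_smul]
  have hfd : ∀ x : 𝔼, fderiv ℝ (fun x => χ x * ‖v n x‖ ^ 2) x x =
      χ x * (2 * ∑ k, x k * inner ℝ (v n x) ((∂_{𝖾 k} (v n)) x)) +
        fderiv ℝ χ x x * inner ℝ (v n x) (v n x) := by
    intro x
    have hd1 : HasFDerivAt (fun x => ‖v n x‖ ^ 2) _ x := ((v n).hasFDerivAt x).norm_sq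
    have hd2 := ((hχ.differentiable one_ne_zero) x).hasFDerivAt.mul hd1
    rw [show (fun x => χ x * ‖v n x‖ ^ 2) = χ * fun x => ‖v n x‖ ^ 2 from rfl, hd2.fderiv]
    simp only [add_apply, smul_apply, ContinuousLinearMap.comp_apply, innerSL_apply_apply,
      smul_eq_mul, hcoord, inner_sum, inner_smul_right, real_inner_self_eq_norm_sq]
    simp
    ring
  simp only [weightedInner_toLp]
  rw [← integral_finsetSum _ fun k _ => integrable_weight_inner_schwartz (hb2 k) _ _,
    ← integral_const_mul, ← integral_add (integrable_weight_inner_schwartz hb1 _ _)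
    ((integrable_finsetSum _ fun k _ => integrable_weight_inner_schwartz (hb2 k) _ _).const_mul 2)]
  refine integral_congr_ae (Eventually.of_forall fun x => ?_)
  simp only [hfd, real_inner_self_eq_norm_sq]
  have hS : ∑ k, m x * (χ x * x k) * inner ℝ (v n x) ((∂_{𝖾 k} (v n)) x) =
      m x * χ x * ∑ k, x k * inner ℝ (v n x) ((∂_{𝖾 k} (v n)) x) := by
    rw [Finset.mul_sum]
    exact Finset.sum_congr rfl fun k _ => by ring
  rw [hS]
  ring

end Identities

/-! ### Cutoff functions and passage to the limit -/

section Cutoff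

variable {N : ℕ}

local notation "𝔼" => EuclideanSpace ℝ (Fin N)
local notation "𝕃²" => Lp ℂ 2 (volume : Measure (EuclideanSpace ℝ (Fin N)))
local notation "𝖾" j:max => (EuclideanSpace.single j (1 : ℝ) : EuclideanSpace ℝ (Fin N))

/-- A sequence of cutoff functions exhausting `ℝ^N` whose gradients are `O(1/|x|)`, uniformly. -/
structure IsCutoffSequence (χ : ℕ → 𝔼 → ℝ) (C : ℝ) : Prop where
  contDiff : ∀ n, ContDiff ℝ 1 (χ n)
  hasCompactSupport : ∀ n, HasCompactSupport (χ n)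
  nonneg : ∀ n x, 0 ≤ χ n x
  le_one : ∀ n x, χ n x ≤ 1
  norm_fderiv_mul_norm_le : ∀ n x, ‖fderiv ℝ (χ n) x‖ * ‖x‖ ≤ C
  eventually_eq : ∀ x, ∀ᶠ n in atTop, χ n x = 1 ∧ fderiv ℝ (χ n) x = 0

theorem exists_isCutoffSequence : ∃ (χ : ℕ → 𝔼 → ℝ) (C : ℝ), IsCutoffSequence χ C := by
  let f : ContDiffBump (0 : 𝔼) := ⟨1, 2, one_pos, one_lt_two⟩
  have hf : ContDiff ℝ 1 f := f.contDiff
  have hpos : ∀ n : ℕ, (0 : ℝ) < ((n : ℝ) + 1)⁻¹ := fun n => by positivity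
  have hfd : ∀ (n : ℕ) (x : 𝔼), fderiv ℝ (fun x => f (((n : ℝ) + 1)⁻¹ • x)) x =
      ((n : ℝ) + 1)⁻¹ • fderiv ℝ f (((n : ℝ) + 1)⁻¹ • x) := fun n x => by
    rw [fderiv_comp_smul]
  have hcs : HasCompactSupport fun x : 𝔼 => ‖fderiv ℝ f x‖ * ‖x‖ :=
    ((f.hasCompactSupport.fderiv (𝕜 := ℝ)).norm).mul_right
  obtain ⟨C, hC⟩ := hcs.exists_bound_of_continuous
    ((hf.continuous_fderiv one_ne_zero).norm.mul continuous_norm)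
  refine ⟨fun n x => f (((n : ℝ) + 1)⁻¹ • x), C, ⟨fun n => ?_, fun n => ?_, fun n x => f.nonneg,
    fun n x => f.le_one, fun n x => ?_, fun x => ?_⟩⟩
  · exact hf.comp (contDiff_const_smul _)
  · exact f.hasCompactSupport.comp_smul (hpos n).ne'
  · have := (le_abs_self _).trans (hC (((n : ℝ) + 1)⁻¹ • x))
    rw [norm_smul, Real.norm_of_nonneg (hpos n).le] at this
    rw [hfd, norm_smul, Real.norm_of_nonneg (hpos n).le]
    linarith
  · have hlim : Tendsto (fun n : ℕ => ((n : ℝ) + 1)⁻¹ • x) atTop (𝓝 0) := by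
      have h1 : Tendsto (fun n : ℕ => ((n : ℝ) + 1)⁻¹) atTop (𝓝 0) := by
        simpa using tendsto_one_div_add_atTop_nhds_zero_nat (𝕜 := ℝ)
      simpa using h1.smul_const x
    have hev : (f : 𝔼 → ℝ) =ᶠ[𝓝 0] fun _ => 1 := f.eventuallyEq_one
    filter_upwards [hlim.eventually hev.eventually_nhds] with n hn
    refine ⟨hn.self_of_nhds, ?_⟩
    have hn' : (f : 𝔼 → ℝ) =ᶠ[𝓝 (((n : ℝ) + 1)⁻¹ • x)] fun _ => 1 := hn
    rw [hfd, hn'.fderiv_eq]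
    simp

theorem abs_coord_le (x : 𝔼) (k : Fin N) : |x k| ≤ ‖x‖ := PiLp.norm_apply_le x k

theorem hasFDerivAt_mul_coord {φ : 𝔼 → ℝ} {φ' : 𝔼 →L[ℝ] ℝ} {x : 𝔼} (h : HasFDerivAt φ φ' x)
    (k : Fin N) :
    HasFDerivAt (fun x : 𝔼 => φ x * x k) (φ x • EuclideanSpace.proj k + x k • φ') x :=
  h.mul (EuclideanSpace.proj k : 𝔼 →L[ℝ] ℝ).hasFDerivAt

theorem contDiff_mul_coord {φ : 𝔼 → ℝ} (h : ContDiff ℝ 1 φ) (k : Fin N) :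
    ContDiff ℝ 1 fun x : 𝔼 => φ x * x k :=
  h.mul (EuclideanSpace.proj k : 𝔼 →L[ℝ] ℝ).contDiff

namespace IsCutoffSequence

variable {χ : ℕ → EuclideanSpace ℝ (Fin N) → ℝ} {C : ℝ}

theorem mul_coord (h : IsCutoffSequence χ C) (n : ℕ) (k : Fin N) :
    IsC1Weight fun x : 𝔼 => χ n x * x k :=
  .of_hasCompactSupport (contDiff_mul_coord (h.contDiff n) k) (h.hasCompactSupport n).mul_right

theorem fderiv_mul_coord (h : IsCutoffSequence χ C) (n : ℕ) (k j : Fin N) (x : 𝔼) :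
    fderiv ℝ (fun x : 𝔼 => χ n x * x k) x (𝖾 j) =
      χ n x * (if k = j then 1 else 0) + x k * fderiv ℝ (χ n) x (𝖾 j) := by
  rw [(hasFDerivAt_mul_coord (((h.contDiff n).differentiable one_ne_zero) x).hasFDerivAt
    k).fderiv]
  simp

theorem abs_fderiv_mul_coord_le (h : IsCutoffSequence χ C) (n : ℕ) (k j : Fin N) (x : 𝔼) :
    |fderiv ℝ (fun x : 𝔼 => χ n x * x k) x (𝖾 j)| ≤ 1 + C := by
  rw [h.fderiv_mul_coord]
  refine (abs_add_le _ _).trans (add_le_add ?_ ?_)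
  · rw [abs_mul, abs_of_nonneg (h.nonneg n x)]
    have := h.le_one n x
    split_ifs <;> simp [this]
  · rw [abs_mul, mul_comm]
    refine le_trans ?_ (h.norm_fderiv_mul_norm_le n x)
    refine mul_le_mul ?_ (abs_coord_le x k) (abs_nonneg _) (norm_nonneg _)
    simpa using (fderiv ℝ (χ n) x).le_opNorm (𝖾 j)

theorem abs_fderiv_self_le (h : IsCutoffSequence χ C) (n : ℕ) (x : 𝔼) :
    |fderiv ℝ (χ n) x x| ≤ C :=
  ((fderiv ℝ (χ n) x).le_opNorm x).trans (h.norm_fderiv_mul_norm_le n x)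

theorem isBddWeight_fderiv_self (h : IsCutoffSequence χ C) (n : ℕ) :
    IsBddWeight fun x => fderiv ℝ (χ n) x x :=
  ⟨((((h.contDiff n).continuous_fderiv one_ne_zero)).clm_apply
    continuous_id).aestronglyMeasurable, C, Eventually.of_forall (h.abs_fderiv_self_le n)⟩

theorem isBddWeight (h : IsCutoffSequence χ C) (n : ℕ) : IsBddWeight (χ n) :=
  (IsC1Weight.of_hasCompactSupport (h.contDiff n) (h.hasCompactSupport n)).isBddWeight

/-- The virial identity for the field `x`: `2 ∫ Re (Δu x·∇ū) = (N - 2) ∫ |∇u|²`, where the left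
side is a limit of truncated integrals. -/
theorem tendsto_virial (hχ : IsCutoffSequence χ C) {u W : 𝕃²} {G : Fin N → 𝕃²}
    (h : HasGradientLaplacian u G W) :
    Tendsto (fun n => 2 * ∑ k, weightedInner (fun x => χ n x * x k) W (G k)) atTop
      (𝓝 (((N : ℝ) - 2) * ∑ j, weightedInner (fun _ => 1) (G j) (G j))) := by
  simp only [fun n => h.virial (hχ.mul_coord n)]
  have key : ∀ (k j : Fin N) (f g : 𝕃²), Tendsto
      (fun n => weightedInner (fun x => fderiv ℝ (fun x : 𝔼 => χ n x * x k) x (𝖾 j)) f g) atTop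
      (𝓝 (weightedInner (fun _ => if k = j then 1 else 0) f g)) := by
    intro k j f g
    refine tendsto_weightedInner_weight (C := 1 + C)
      (fun n => ((hχ.mul_coord n k).isBddWeight_fderiv (𝖾 j)).meas)
      (fun n => Eventually.of_forall fun x => hχ.abs_fderiv_mul_coord_le n k j x)
      (Eventually.of_forall fun x => ?_) f g
    refine tendsto_const_nhds.congr' ?_
    filter_upwards [hχ.eventually_eq x] with n hn
    rw [hχ.fderiv_mul_coord, hn.1, hn.2]
    simp
  have h1 := tendsto_finsetSum Finset.univ fun k _ => tendsto_finsetSum Finset.univ fun j _ =>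
    key k k (G j) (G j)
  have h2 := (tendsto_finsetSum Finset.univ fun k _ => tendsto_finsetSum Finset.univ fun j _ =>
    key k j (G j) (G k)).const_mul 2
  convert h1.sub h2 using 2
  have h0 : ∀ f g : 𝕃², weightedInner (fun _ => 0) f g = 0 := fun f g => by simp [weightedInner]
  have hsum : ∀ k : Fin N, ∑ j, weightedInner (fun _ => if k = j then 1 else 0) (G j) (G k) =
      weightedInner (fun _ => 1) (G k) (G k) := fun k => by
    rw [Finset.sum_eq_single k]
    · simp
    · intro j _ hj
      simp [hj.symm, h0]
    · simp
  simp only [hsum, if_true, Finset.sum_const, Finset.card_univ, Fintype.card_fin, nsmul_eq_mul]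
  ring

theorem tendsto_weightedInner_mul (hχ : IsCutoffSequence χ C) {b : 𝔼 → ℝ} (hb : IsBddWeight b)
    (f g : 𝕃²) :
    Tendsto (fun n => weightedInner (fun x => χ n x * b x) f g) atTop
      (𝓝 (weightedInner b f g)) := by
  obtain ⟨B, hB⟩ := hb.bdd
  refine tendsto_weightedInner_weight (C := B) (fun n => ((hχ.isBddWeight n).mul hb).meas)
    (fun n => ?_) (Eventually.of_forall fun x => ?_) f g
  · filter_upwards [hB] with x hx
    rw [abs_mul, abs_of_nonneg (hχ.nonneg n x)]
    exact (mul_le_of_le_one_left (abs_nonneg _) (hχ.le_one n x)).trans hx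
  · refine tendsto_const_nhds.congr' ?_
    filter_upwards [hχ.eventually_eq x] with n hn
    rw [hn.1, one_mul]

/-- `p ∫ m |u|² + 2 ∫ m Re (ū x·∇u) ≤ 0` when `m` is monotone along rays; the second integral
exists as a limit of truncated integrals only. -/
theorem monotone_weight_limit (hχ : IsCutoffSequence χ C) {u W : 𝕃²} {G : Fin N → 𝕃²}
    (h : HasGradientLaplacian u G W) {m : 𝔼 → ℝ} (hm : IsBddWeight m) {α p : ℕ}
    (hαp : p + α = N) (hmono : ∀ s : ℝ, 1 < s → ∀ᵐ x, m x ≤ s ^ α * m (s • x)) {l : ℝ}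
    (hl : Tendsto (fun n => 2 * ∑ k, weightedInner (fun x => m x * (χ n x * x k)) u (G k)) atTop
      (𝓝 l)) :
    p * weightedInner m u u + l ≤ 0 := by
  obtain ⟨B, hB⟩ := hm.bdd
  have h1 : Tendsto
      (fun n => weightedInner (fun x => m x * (p * χ n x + fderiv ℝ (χ n) x x)) u u) atTop
      (𝓝 (weightedInner (fun x => p * m x) u u)) := by
    refine tendsto_weightedInner_weight (C := B * (p + C))
      (fun n => (hm.mul (((IsBddWeight.const (p : ℝ)).mul (hχ.isBddWeight n)).add
        (hχ.isBddWeight_fderiv_self n))).meas) (fun n => ?_)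
      (Eventually.of_forall fun x => ?_) u u
    · filter_upwards [hB] with x hx
      rw [abs_mul]
      refine mul_le_mul hx ?_ (abs_nonneg _) ((abs_nonneg _).trans hx)
      refine (abs_add_le _ _).trans (add_le_add ?_ (hχ.abs_fderiv_self_le n x))
      rw [abs_mul, abs_of_nonneg (hχ.nonneg n x), Nat.abs_cast]
      exact mul_le_of_le_one_right p.cast_nonneg (hχ.le_one n x)
    · refine tendsto_const_nhds.congr' ?_
      filter_upwards [hχ.eventually_eq x] with n hn
      rw [hn.1, hn.2]
      simp [mul_comm]
  rw [weightedInner_const_mul] at h1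
  exact le_of_tendsto' (h1.add hl) fun n => h.monotone_weight hm hαp hmono (hχ.contDiff n)
    (hχ.hasCompactSupport n) (hχ.nonneg n) (hχ.isBddWeight_fderiv_self n) (hχ.mul_coord n)

end IsCutoffSequence

end Cutoff

/-! ### A positive divergence -/

section Divergence

variable {N : ℕ}

local notation "𝔼" => EuclideanSpace ℝ (Fin N)
local notation "𝕃²" => Lp ℂ 2 (volume : Measure (EuclideanSpace ℝ (Fin N)))
local notation "𝖾" j:max => (EuclideanSpace.single j (1 : ℝ) : EuclideanSpace ℝ (Fin N))

/-- The function `1 / (1 + |x|²)`. -/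
noncomputable def recipOneAddNormSq (x : 𝔼) : ℝ := (1 + ‖x‖ ^ 2)⁻¹

local notation "𝗉" => recipOneAddNormSq

theorem recipOneAddNormSq_pos (x : 𝔼) : 0 < 𝗉 x := by
  unfold recipOneAddNormSq
  positivity

theorem normSq_mul_recipOneAddNormSq (x : 𝔼) : ‖x‖ ^ 2 * 𝗉 x = 1 - 𝗉 x := by
  unfold recipOneAddNormSq
  have : (1 + ‖x‖ ^ 2) ≠ 0 := by positivity
  field_simp
  ring

theorem recipOneAddNormSq_le_one (x : 𝔼) : 𝗉 x ≤ 1 := by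
  have := normSq_mul_recipOneAddNormSq x
  have h2 := (recipOneAddNormSq_pos x).le
  nlinarith [sq_nonneg ‖x‖, mul_nonneg (sq_nonneg ‖x‖) h2]

theorem norm_mul_recipOneAddNormSq_le_one (x : 𝔼) : ‖x‖ * 𝗉 x ≤ 1 := by
  have := normSq_mul_recipOneAddNormSq x
  have h2 := (recipOneAddNormSq_pos x).le
  nlinarith [mul_nonneg (sq_nonneg (‖x‖ - 1)) h2]

theorem hasFDerivAt_recipOneAddNormSq (x : 𝔼) :
    HasFDerivAt (𝗉 : 𝔼 → ℝ) ((-2 * 𝗉 x ^ 2) • innerSL ℝ x) x := by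
  have h1 : HasFDerivAt (fun x : 𝔼 => 1 + ‖x‖ ^ 2) (2 • innerSL ℝ x) x := by
    simpa using (hasStrictFDerivAt_norm_sq x).hasFDerivAt.const_add 1
  have h2 := (hasDerivAt_inv (show 1 + ‖x‖ ^ 2 ≠ 0 by positivity)).comp_hasFDerivAt x h1
  have h3 : (-2 * 𝗉 x ^ 2) • innerSL ℝ x =
      -((1 + ‖x‖ ^ 2) ^ 2)⁻¹ • 2 • (innerSL ℝ x : 𝔼 →L[ℝ] ℝ) := by
    ext y
    simp [recipOneAddNormSq]
    ring
  rw [h3]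
  exact h2

theorem contDiff_recipOneAddNormSq : ContDiff ℝ 1 (𝗉 : 𝔼 → ℝ) :=
  (contDiff_const.add (contDiff_norm_sq ℝ)).inv fun x => by positivity

theorem isC1Weight_recipOneAddNormSq : IsC1Weight (𝗉 : 𝔼 → ℝ) := by
  refine ⟨contDiff_recipOneAddNormSq, ⟨1, fun x => ?_⟩, ⟨2, fun x => ?_⟩⟩
  · rw [abs_of_pos (recipOneAddNormSq_pos x)]
    exact recipOneAddNormSq_le_one x
  · rw [(hasFDerivAt_recipOneAddNormSq x).fderiv, norm_smul, innerSL_apply_norm, norm_mul,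
      norm_neg, Real.norm_of_nonneg (sq_nonneg _), Real.norm_two]
    nlinarith [recipOneAddNormSq_pos x, recipOneAddNormSq_le_one x,
      norm_mul_recipOneAddNormSq_le_one x, norm_nonneg x,
      mul_nonneg (norm_nonneg x) (recipOneAddNormSq_pos x).le]

theorem isC1Weight_recipOneAddNormSq_mul_coord (k : Fin N) :
    IsC1Weight fun x : 𝔼 => 𝗉 x * x k := by
  refine ⟨contDiff_mul_coord contDiff_recipOneAddNormSq k, ⟨1, fun x => ?_⟩, ⟨1 + 2, fun x => ?_⟩⟩
  · rw [abs_mul, abs_of_pos (recipOneAddNormSq_pos x)]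
    have := mul_le_mul_of_nonneg_left (abs_coord_le x k) (recipOneAddNormSq_pos x).le
    linarith [norm_mul_recipOneAddNormSq_le_one x]
  · rw [(hasFDerivAt_mul_coord (hasFDerivAt_recipOneAddNormSq x) k).fderiv]
    have hp := recipOneAddNormSq_pos x
    have h1 := recipOneAddNormSq_le_one x
    have h2 := normSq_mul_recipOneAddNormSq x
    refine ContinuousLinearMap.opNorm_le_bound _ (by norm_num) fun y => ?_
    have e1 : (𝗉 x • EuclideanSpace.proj k + x k • (-2 * 𝗉 x ^ 2) • innerSL ℝ x : 𝔼 →L[ℝ] ℝ) y =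
        𝗉 x * y k + x k * (-2 * 𝗉 x ^ 2 * inner ℝ x y) := by simp
    rw [e1, add_mul]
    refine (norm_add_le _ _).trans (add_le_add ?_ ?_)
    · rw [norm_mul, Real.norm_of_nonneg hp.le]
      exact mul_le_mul h1 (abs_coord_le y k) (norm_nonneg _) zero_le_one
    · have h3 : |x k| * |inner ℝ x y| ≤ ‖x‖ * (‖x‖ * ‖y‖) :=
        mul_le_mul (abs_coord_le x k) (abs_real_inner_le_norm x y) (abs_nonneg _) (norm_nonneg _)
      have e2 : ‖x k * (-2 * 𝗉 x ^ 2 * inner ℝ x y)‖ = 2 * 𝗉 x ^ 2 * (|x k| * |inner ℝ x y|) := by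
        rw [norm_mul, norm_mul, norm_mul, norm_neg, Real.norm_two,
          Real.norm_of_nonneg (sq_nonneg (𝗉 x))]
        simp only [Real.norm_eq_abs]
        ring
      rw [e2]
      calc 2 * 𝗉 x ^ 2 * (|x k| * |inner ℝ x y|) ≤ 2 * 𝗉 x ^ 2 * (‖x‖ * (‖x‖ * ‖y‖)) := by gcongr
        _ = 2 * (𝗉 x * (‖x‖ ^ 2 * 𝗉 x)) * ‖y‖ := by ring
        _ ≤ 2 * ‖y‖ := by
          rw [h2]
          gcongr
          nlinarith

/-- The components of the bounded vector field `w = (N - 2 / (1 + |x|²)) x / (1 + |x|²)`. Its two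
properties of interest are `div w > 0` for `x ≠ 0` and `x·w = N φ - x·∇φ` for
`φ = 1 - 1 / (1 + |x|²)`. -/
noncomputable def divergenceField (k : Fin N) (x : 𝔼) : ℝ := 𝗉 x * x k * (N - 2 * 𝗉 x)

theorem isC1Weight_divergenceField (k : Fin N) :
    IsC1Weight (divergenceField k : 𝔼 → ℝ) :=
  (isC1Weight_recipOneAddNormSq_mul_coord k).mul
    ((IsC1Weight.const (N : ℝ)).sub ((IsC1Weight.const 2).mul isC1Weight_recipOneAddNormSq))

theorem fderiv_recipOneAddNormSq_single (k : Fin N) (x : 𝔼) :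
    fderiv ℝ (𝗉 : 𝔼 → ℝ) x (𝖾 k) = -2 * 𝗉 x ^ 2 * x k := by
  rw [(hasFDerivAt_recipOneAddNormSq x).fderiv]
  simp [EuclideanSpace.inner_single_right]

theorem sum_coord_sq (x : 𝔼) : ∑ k, x k ^ 2 = ‖x‖ ^ 2 := (EuclideanSpace.real_norm_sq_eq x).symm

theorem sum_fderiv_divergenceField (x : 𝔼) :
    ∑ k, fderiv ℝ (divergenceField k : 𝔼 → ℝ) x (𝖾 k) =
      N * (N - 2) * 𝗉 x + 8 * 𝗉 x ^ 2 * (1 - 𝗉 x) := by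
  have hterm : ∀ k : Fin N, fderiv ℝ (divergenceField k : 𝔼 → ℝ) x (𝖾 k) =
      𝗉 x * (N - 2 * 𝗉 x) + (8 * 𝗉 x ^ 3 - 2 * N * 𝗉 x ^ 2) * x k ^ 2 := by
    intro k
    have h1 := hasFDerivAt_mul_coord (hasFDerivAt_recipOneAddNormSq x) k
    have h2 := ((hasFDerivAt_recipOneAddNormSq x).const_mul 2).const_sub (N : ℝ)
    have h3 : HasFDerivAt (divergenceField k : 𝔼 → ℝ) _ x := h1.mul h2
    rw [h3.fderiv]
    simp [EuclideanSpace.inner_single_right]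
    ring
  simp only [hterm, Finset.sum_add_distrib, ← Finset.mul_sum, sum_coord_sq, Finset.sum_const,
    Finset.card_univ, Fintype.card_fin, nsmul_eq_mul]
  linear_combination (8 * 𝗉 x ^ 2 - 2 * N * 𝗉 x) * normSq_mul_recipOneAddNormSq x

theorem sum_coord_mul_divergenceField (x : 𝔼) :
    ∑ k, x k * divergenceField k x = (1 - 𝗉 x) * (N - 2 * 𝗉 x) := by
  have : ∀ k : Fin N, x k * divergenceField k x = 𝗉 x * (N - 2 * 𝗉 x) * x k ^ 2 := fun k => by
    unfold divergenceField
    ring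
  simp only [this, ← Finset.mul_sum, sum_coord_sq]
  linear_combination (N - 2 * 𝗉 x) * normSq_mul_recipOneAddNormSq x

/-- The field `w = divergenceField` has `div w > 0`, hence `∫ Re (ū w·∇u) = 0` forces `u = 0`. -/
theorem HasGradientLaplacian.eq_zero_of_sum_eq_zero (hN : 2 ≤ N) {u W : 𝕃²} {G : Fin N → 𝕃²}
    (h : HasGradientLaplacian u G W)
    (h0 : ∑ k, weightedInner (divergenceField k) u (G k) = 0) : u = 0 := by
  have : Nonempty (Fin N) := ⟨⟨0, by omega⟩⟩
  have hN' : (2 : ℝ) ≤ N := by exact_mod_cast hN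
  have hb := fun k : Fin N => (isC1Weight_divergenceField k).isBddWeight_fderiv (𝖾 k)
  have h1 : ∑ k : Fin N,
      weightedInner (fun x => fderiv ℝ (divergenceField k : 𝔼 → ℝ) x (𝖾 k)) u u = 0 := by
    have := Finset.sum_congr rfl fun k (_ : k ∈ Finset.univ) =>
      h.integral_fderiv_normSq (isC1Weight_divergenceField k) k
    rw [Finset.sum_add_distrib, ← Finset.mul_sum, h0] at this
    simpa using this
  simp only [weightedInner] at h1
  rw [← integral_finsetSum _ fun k _ => integrable_weightedInner (hb k) u u] at h1
  have hcongr : ∀ x : 𝔼, ∑ k : Fin N, fderiv ℝ (divergenceField k : 𝔼 → ℝ) x (𝖾 k) *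
      inner ℝ (u x) (u x) = (N * (N - 2) * 𝗉 x + 8 * 𝗉 x ^ 2 * (1 - 𝗉 x)) * ‖u x‖ ^ 2 := by
    intro x
    rw [← Finset.sum_mul, sum_fderiv_divergenceField, real_inner_self_eq_norm_sq]
  have hint := integrable_finsetSum Finset.univ fun k (_ : k ∈ Finset.univ) =>
    integrable_weightedInner (hb k) u u
  have hp1 : ∀ x : 𝔼, 0 ≤ 1 - 𝗉 x := fun x => by linarith [recipOneAddNormSq_le_one x]
  have hA : ∀ x : 𝔼, 0 ≤ N * (N - 2) * 𝗉 x := fun x =>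
    mul_nonneg (mul_nonneg (by linarith) (by linarith)) (recipOneAddNormSq_pos x).le
  have hz := (integral_eq_zero_iff_of_nonneg (fun x => by
    simp only [Pi.zero_apply, hcongr]
    have := hA x
    have := hp1 x
    positivity) hint).1 h1
  rw [Lp.eq_zero_iff_ae_eq_zero]
  have hne : ∀ᵐ x : 𝔼, x ≠ 0 := by simp [ae_iff]
  filter_upwards [hz, hne] with x hx hx0
  simp only [Pi.zero_apply, hcongr] at hx
  have hpos : 0 < 1 - 𝗉 x := by
    rw [← normSq_mul_recipOneAddNormSq]
    have := recipOneAddNormSq_pos x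
    positivity
  have hp := recipOneAddNormSq_pos x
  have := hA x
  have hc : N * (N - 2) * 𝗉 x + 8 * 𝗉 x ^ 2 * (1 - 𝗉 x) ≠ 0 := by positivity
  simpa [hc] using hx

end Divergence

/-! ### Eigenfunctions -/

section Eigenfunctions

variable {N : ℕ}

local notation "𝔼" => EuclideanSpace ℝ (Fin N)
local notation "𝕃²" => Lp ℂ 2 (volume : Measure (EuclideanSpace ℝ (Fin N)))
local notation "𝖾" j:max => (EuclideanSpace.single j (1 : ℝ) : EuclideanSpace ℝ (Fin N))

theorem IsAdmissibleWeight.isBddWeight {μ : 𝔼 → ℝ} (hμ : IsAdmissibleWeight μ) :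
    IsBddWeight μ := by
  obtain ⟨m, M, hm, h⟩ := hμ.bounds
  exact ⟨hμ.aemeasurable.aestronglyMeasurable, M, Eventually.of_forall fun x => by
    rw [abs_of_pos (by linarith [(h x).1])]
    exact (h x).2⟩

/-- An eigenvector of the reduced wave operator is a nonzero `u` in `H²` with `Δu = -z μ u`. -/
theorem exists_of_mem_pointSpectrum {μ : 𝔼 → ℝ} (hμ : IsAdmissibleWeight μ) {z : ℂ}
    (hz : z ∈ pointSpectrum (reducedWaveOperator hμ)) :
    ∃ (u W : 𝕃²) (G : Fin N → 𝕃²), u ≠ 0 ∧ HasGradientLaplacian u G W ∧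
      ∀ᵐ x, W x = -(z * (μ x * u x)) := by
  obtain ⟨f, hf0, hf⟩ := hz
  set u : sobolevH2 N := ⟨hμ.toL2 f, f.2⟩ with hu
  obtain ⟨G, hG⟩ := exists_hasGradientLaplacian u
  have hfu : ∀ᵐ x, hμ.toL2 (f : WeightedL2 μ) x = (f : WeightedL2 μ) x :=
    MemLp.coeFn_toLp (hμ.memLp_iff.1 (Lp.memLp (f : WeightedL2 μ)))
  obtain ⟨m, M, hm, hb⟩ := hμ.bounds
  refine ⟨hμ.toL2 f, laplacianH2 N u, G, ?_, hG, ?_⟩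
  · intro h0
    apply hf0
    rw [Lp.eq_zero_iff_ae_eq_zero] at h0 ⊢
    refine hμ.absolutelyContinuous.ae_le ?_
    filter_upwards [h0, hfu] with x h1 h2
    rw [← h2, h1]
  · have h1 : ∀ᵐ x, (reducedWaveOperator hμ f : WeightedL2 μ) x =
        -((μ x : ℂ)⁻¹ * laplacianH2 N u x) :=
      hμ.absolutelyContinuous'.ae_le (MemLp.coeFn_toLp (hμ.memLp_neg_inv_mul (laplacianH2 N u)))
    have h2 := hμ.absolutelyContinuous'.ae_le (Lp.coeFn_smul z (f : WeightedL2 μ))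
    filter_upwards [h1, h2, hfu] with x h1 h2 h3
    rw [hf, h2] at h1
    rw [h3]
    have hμ0 : (μ x : ℂ) ≠ 0 := by
      have := (hb x).1
      exact_mod_cast (show μ x ≠ 0 by linarith)
    simp only [Pi.smul_apply, smul_eq_mul] at h1
    field_simp at h1
    linear_combination h1

variable {μ : EuclideanSpace ℝ (Fin N) → ℝ}
  {u W : Lp ℂ 2 (volume : Measure (EuclideanSpace ℝ (Fin N)))}
  {G : Fin N → Lp ℂ 2 (volume : Measure (EuclideanSpace ℝ (Fin N)))}

/-- Eigenvalues are real. -/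
theorem HasGradientLaplacian.im_eq_zero (hμ : IsAdmissibleWeight μ) {z : ℂ} (hu : u ≠ 0)
    (h : HasGradientLaplacian u G W) (hW : ∀ᵐ x, W x = -(z * (μ x * u x))) : z.im = 0 := by
  obtain ⟨m, M, hm, hb⟩ := hμ.bounds
  by_contra hz
  refine hu (eq_zero_of_weightedInner_self_le hμ.isBddWeight
    (Eventually.of_forall fun x => hm.trans_le (hb x).1) (le_of_eq ?_))
  have h1 := h.weightedInner_I_smul
  have h2 : weightedInner (fun _ => 1) (Complex.I • u) W =
      weightedInner (fun x => -z.im * μ x) u u := by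
    refine weightedInner_congr ?_
    filter_upwards [hW, Lp.coeFn_smul Complex.I u] with x h1 h2
    rw [h1, h2]
    simp [Complex.inner, ← Complex.normSq_eq_norm_sq, Complex.normSq_apply]
    ring
  rw [h2, weightedInner_const_mul] at h1
  simpa [hz] using h1

/-- `∫ φ |∇u|² + ∫ Re (ū ∇φ·∇u) = lam ∫ φ μ |u|²`. -/
theorem HasGradientLaplacian.green_of_eq (h : HasGradientLaplacian u G W) {lam : ℝ}
    (hW : ∀ᵐ x, W x = -((lam : ℂ) * (μ x * u x))) {φ : 𝔼 → ℝ} (hφ : IsC1Weight φ) :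
    ∑ j, weightedInner φ (G j) (G j) +
      ∑ j, weightedInner (fun x => fderiv ℝ φ x (𝖾 j)) u (G j) =
      lam * weightedInner (fun x => φ x * μ x) u u := by
  have h1 := h.green hφ
  have h2 : weightedInner φ u W = weightedInner (fun x => -lam * (φ x * μ x)) u u := by
    refine weightedInner_congr ?_
    filter_upwards [hW] with x h1
    rw [h1]
    simp [Complex.inner, ← Complex.normSq_eq_norm_sq, Complex.normSq_apply]
    ring
  rw [h2, weightedInner_const_mul] at h1
  linarith

/-- `∫ |∇u|² = lam ∫ μ |u|²`. -/
theorem HasGradientLaplacian.sum_normSq_gradient (h : HasGradientLaplacian u G W) {lam : ℝ}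
    (hW : ∀ᵐ x, W x = -((lam : ℂ) * (μ x * u x))) :
    ∑ j, weightedInner (fun _ => 1) (G j) (G j) = lam * weightedInner μ u u := by
  have := h.green_of_eq hW (IsC1Weight.const 1)
  simpa [weightedInner] using this

/-- Zero is not an eigenvalue: the gradient of `u` would vanish. -/
theorem HasGradientLaplacian.eq_zero_of_eigenvalue_zero (hN : 2 ≤ N)
    (h : HasGradientLaplacian u G W) (hW : ∀ᵐ x, W x = 0) : u = 0 := by
  have h1 := h.sum_normSq_gradient (μ := fun _ => 1) (lam := 0) (by simpa using hW)
  rw [zero_mul, Finset.sum_eq_zero_iff_of_nonneg fun j _ =>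
    weightedInner_self_nonneg (Eventually.of_forall fun _ => zero_le_one) _] at h1
  have hG : ∀ j, G j = 0 := fun j => eq_zero_of_weightedInner_self_le (IsBddWeight.const 1)
    (Eventually.of_forall fun _ => one_pos) (h1 j (Finset.mem_univ j)).le
  refine h.eq_zero_of_sum_eq_zero hN (Finset.sum_eq_zero fun k _ => ?_)
  rw [hG]
  refine integral_eq_zero_of_ae ?_
  filter_upwards [Lp.coeFn_zero ℂ 2 (volume : Measure 𝔼)] with x hx
  rw [hx]
  simp

/-- `2 ∫ μ Re (ū x·∇u) = -(N - 2) ∫ μ |u|²` for an eigenfunction `u`, the first integral being a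
limit of truncated ones. -/
theorem IsCutoffSequence.tendsto_eigenfunction {χ : ℕ → 𝔼 → ℝ} {C : ℝ}
    (hχ : IsCutoffSequence χ C) (h : HasGradientLaplacian u G W) {lam : ℝ} (hlam : 0 < lam)
    (hW : ∀ᵐ x, W x = -((lam : ℂ) * (μ x * u x))) :
    Tendsto (fun n => 2 * ∑ k, weightedInner (fun x => μ x * (χ n x * x k)) u (G k)) atTop
      (𝓝 (-((N : ℝ) - 2) * weightedInner μ u u)) := by
  have h1 := (hχ.tendsto_virial h).const_mul (-lam⁻¹)
  rw [h.sum_normSq_gradient hW] at h1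
  have e1 : -lam⁻¹ * (((N : ℝ) - 2) * (lam * weightedInner μ u u)) =
      -((N : ℝ) - 2) * weightedInner μ u u := by
    field_simp
  rw [e1] at h1
  refine h1.congr fun n => ?_
  have e2 : ∀ k, weightedInner (fun x => χ n x * x k) W (G k) =
      -lam * weightedInner (fun x => μ x * (χ n x * x k)) u (G k) := fun k => by
    rw [← weightedInner_const_mul]
    refine weightedInner_congr ?_
    filter_upwards [hW] with x h1
    rw [h1]
    simp [Complex.inner]
    ring
  simp only [e2, ← Finset.mul_sum]
  field_simp

/-! ### Absence of positive eigenvalues -/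

/-- There is no positive eigenvalue if `r ↦ r μ(r x)` is nondecreasing for almost every `x`. -/
theorem HasGradientLaplacian.eq_zero_of_monotone_mul (hμ : IsAdmissibleWeight μ) (hN : 2 ≤ N)
    (hmono : ∀ s : ℝ, 1 < s → ∀ᵐ x, μ x ≤ s * μ (s • x))
    (h : HasGradientLaplacian u G W) {lam : ℝ} (hlam : 0 < lam)
    (hW : ∀ᵐ x, W x = -((lam : ℂ) * (μ x * u x))) : u = 0 := by
  obtain ⟨χ, C, hχ⟩ := exists_isCutoffSequence (N := N)
  have h1 := hχ.monotone_weight_limit h hμ.isBddWeight (α := 1) (p := N - 1) (by omega)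
    (by simpa using hmono) (hχ.tendsto_eigenfunction h hlam hW)
  rw [Nat.cast_sub (by omega)] at h1
  obtain ⟨m, M, hm, hb⟩ := hμ.bounds
  refine eq_zero_of_weightedInner_self_le hμ.isBddWeight
    (Eventually.of_forall fun x => hm.trans_le (hb x).1) ?_
  push_cast at h1
  linarith

/-- The equality case: a solution of the first order system `∇u = lam μ₁ x u` which satisfies
`(μ - N μ₁ - lam |x|² μ₁²) |u|² = 0` vanishes. Green's formula for `φ = 1 - 1 / (1 + |x|²)` becomes
the relation `∫ Re (ū w·∇u) = 0` for the field `w = divergenceField`. -/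
theorem HasGradientLaplacian.eq_zero_of_gradient_eq (hμ : IsAdmissibleWeight μ) (hN : 2 ≤ N)
    {μ₁ : 𝔼 → ℝ} (h : HasGradientLaplacian u G W) {lam : ℝ}
    (hW : ∀ᵐ x, W x = -((lam : ℂ) * (μ x * u x)))
    (hG : ∀ k, ∀ᵐ x, G k x = (lam * μ₁ x * x k) • u x)
    (hu : ∀ᵐ x, (μ x - N * μ₁ x - lam * (‖x‖ * μ₁ x) ^ 2) * ‖u x‖ ^ 2 = 0) : u = 0 := by
  refine h.eq_zero_of_sum_eq_zero hN ?_
  have hφ : IsC1Weight fun x : 𝔼 => 1 - recipOneAddNormSq x :=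
    (IsC1Weight.const 1).sub isC1Weight_recipOneAddNormSq
  have hdφ : ∀ (x : 𝔼) (j : Fin N), fderiv ℝ (fun x : 𝔼 => 1 - recipOneAddNormSq x) x (𝖾 j) =
      2 * recipOneAddNormSq x ^ 2 * x j := fun x j => by
    rw [fderiv_const_sub, neg_apply, fderiv_recipOneAddNormSq_single]
    ring
  have b1 := fun k : Fin N => (isC1Weight_divergenceField k).isBddWeight
  have b3 := fun k : Fin N => hφ.isBddWeight_fderiv (𝖾 k)
  have b4 := hφ.isBddWeight.mul hμ.isBddWeight
  have h1 := h.green_of_eq hW hφ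
  have i2 := integrable_sum_weightedInner (fun _ => hφ.isBddWeight) G G
  have i3 := integrable_sum_weightedInner b3 (fun _ => u) G
  have i4 := (integrable_weightedInner b4 u u).const_mul lam
  have i23 : Integrable fun x =>
      ∑ j, (1 - recipOneAddNormSq x) * inner ℝ (G j x) (G j x) +
      ∑ j, fderiv ℝ (fun x : 𝔼 => 1 - recipOneAddNormSq x) x (𝖾 j) * inner ℝ (u x) (G j x) :=
    i2.add i3
  rw [sum_weightedInner (fun _ => hφ.isBddWeight), sum_weightedInner b3 (fun _ => u),
    weightedInner, ← integral_const_mul, ← integral_add i2 i3] at h1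
  have key : (fun x => ∑ k, divergenceField k x * inner ℝ (u x) (G k x)) =ᵐ[volume] fun x =>
      lam * ((1 - recipOneAddNormSq x) * μ x * inner ℝ (u x) (u x)) -
      (∑ j, (1 - recipOneAddNormSq x) * inner ℝ (G j x) (G j x) +
      ∑ j, fderiv ℝ (fun x : 𝔼 => 1 - recipOneAddNormSq x) x (𝖾 j) * inner ℝ (u x) (G j x)) := by
    filter_upwards [ae_all_iff.2 hG, hu] with x hx hux
    have e1 : ∑ k, divergenceField k x * inner ℝ (u x) (G k x) =
        lam * μ₁ x * ‖u x‖ ^ 2 * ∑ k, x k * divergenceField k x := by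
      rw [Finset.mul_sum]
      refine Finset.sum_congr rfl fun k _ => ?_
      rw [hx, inner_smul_right, real_inner_self_eq_norm_sq]
      ring
    have e2 : ∑ j, (1 - recipOneAddNormSq x) * inner ℝ (G j x) (G j x) =
        (1 - recipOneAddNormSq x) * (lam * μ₁ x) ^ 2 * ‖u x‖ ^ 2 * ∑ j, x j ^ 2 := by
      rw [Finset.mul_sum]
      refine Finset.sum_congr rfl fun k _ => ?_
      rw [hx, real_inner_smul_left, inner_smul_right, real_inner_self_eq_norm_sq]
      ring
    have e3 : ∑ j, fderiv ℝ (fun x : 𝔼 => 1 - recipOneAddNormSq x) x (𝖾 j) *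
        inner ℝ (u x) (G j x) =
        2 * recipOneAddNormSq x ^ 2 * (lam * μ₁ x) * ‖u x‖ ^ 2 * ∑ j, x j ^ 2 := by
      rw [Finset.mul_sum]
      refine Finset.sum_congr rfl fun k _ => ?_
      rw [hdφ, hx, inner_smul_right, real_inner_self_eq_norm_sq]
      ring
    rw [e1, e2, e3, sum_coord_mul_divergenceField, sum_coord_sq, real_inner_self_eq_norm_sq]
    linear_combination (-lam * (1 - recipOneAddNormSq x)) * hux +
      (2 * recipOneAddNormSq x * lam * μ₁ x * ‖u x‖ ^ 2) * normSq_mul_recipOneAddNormSq x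
  rw [sum_weightedInner b1 (fun _ => u), integral_congr_ae key, integral_sub i4 i23, h1, sub_self]

/-- There is no eigenvalue in `(0, lam₀]` if `μ₀ = μ - μ₁` is monotone along rays and
`N μ₁ + lam₀ |x|² μ₁² ≤ μ`. -/
theorem HasGradientLaplacian.eq_zero_of_monotone (hμ : IsAdmissibleWeight μ) (hN : 2 ≤ N)
    {μ₀ μ₁ : 𝔼 → ℝ} (hμ₀ : IsBddWeight μ₀) (hsum : ∀ x, μ x = μ₀ x + μ₁ x)
    (hmono : ∀ s : ℝ, 1 < s → ∀ᵐ x, μ₀ x ≤ μ₀ (s • x)) {lam₀ lam : ℝ} (hlam : 0 < lam)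
    (hle : lam ≤ lam₀) (hcond : ∀ᵐ x, N * μ₁ x + lam₀ * (‖x‖ * |μ₁ x|) ^ 2 ≤ μ x)
    (h : HasGradientLaplacian u G W) (hW : ∀ᵐ x, W x = -((lam : ℂ) * (μ x * u x))) : u = 0 := by
  have hlam₀ : 0 < lam₀ := hlam.trans_le hle
  have hb1 : IsBddWeight μ₁ := by
    have e : μ₁ = fun x => μ x - μ₀ x := funext fun x => by rw [hsum]; ring
    rw [e]
    exact hμ.isBddWeight.sub hμ₀
  have hcoord : ∀ k : Fin N, Continuous fun x : 𝔼 => x k := fun k =>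
    (EuclideanSpace.proj k : 𝔼 →L[ℝ] ℝ).continuous
  have hbq : IsBddWeight fun x => μ x - N * μ₁ x :=
    hμ.isBddWeight.sub ((IsBddWeight.const (N : ℝ)).mul hb1)
  -- the hypothesis bounds `|x| |μ₁|`
  have hbr : ∀ k : Fin N, IsBddWeight fun x : 𝔼 => μ₁ x * x k := by
    intro k
    obtain ⟨B, hB⟩ := hbq.bdd
    refine ⟨hb1.meas.mul (hcoord k).aestronglyMeasurable, B / lam₀ + 1, ?_⟩
    filter_upwards [hB, hcond] with x h1 h2
    have h3 : (‖x‖ * |μ₁ x|) ^ 2 ≤ B / lam₀ := by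
      rw [le_div_iff₀ hlam₀]
      linarith [(le_abs_self _).trans h1]
    have h4 : |μ₁ x * x k| ≤ ‖x‖ * |μ₁ x| := by
      rw [abs_mul, mul_comm]
      exact mul_le_mul_of_nonneg_right (abs_coord_le x k) (abs_nonneg _)
    nlinarith [sq_nonneg (‖x‖ * |μ₁ x| - 1)]
  obtain ⟨χ, C, hχ⟩ := exists_isCutoffSequence (N := N)
  have hl : Tendsto (fun n => 2 * ∑ k, weightedInner (fun x => μ₀ x * (χ n x * x k)) u (G k)) atTop
      (𝓝 (-((N : ℝ) - 2) * weightedInner μ u u -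
        2 * ∑ k, weightedInner (fun x => μ₁ x * x k) u (G k))) := by
    refine ((hχ.tendsto_eigenfunction h hlam hW).sub ((tendsto_finsetSum Finset.univ fun k _ =>
      hχ.tendsto_weightedInner_mul (hbr k) u (G k)).const_mul 2)).congr fun n => ?_
    rw [← mul_sub, ← Finset.sum_sub_distrib]
    congr 1
    refine Finset.sum_congr rfl fun k _ => ?_
    rw [← weightedInner_sub (hμ.isBddWeight.mul (hχ.mul_coord n k).isBddWeight)
      ((hχ.isBddWeight n).mul (hbr k))]
    congr 1
    ext x
    rw [hsum]
    ring
  have h1 := hχ.monotone_weight_limit h hμ₀ (α := 0) (p := N) (by omega)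
    (by simpa using hmono) hl
  have e0 : weightedInner μ₀ u u = weightedInner μ u u - weightedInner μ₁ u u := by
    rw [← weightedInner_sub hμ.isBddWeight hb1]
    congr 1
    ext x
    rw [hsum]
    ring
  have e1 : weightedInner (fun x => μ x - N * μ₁ x) u u =
      weightedInner μ u u - N * weightedInner μ₁ u u := by
    rw [weightedInner_sub hμ.isBddWeight ((IsBddWeight.const (N : ℝ)).mul hb1),
      weightedInner_const_mul]
  -- completing the square
  have i1 := integrable_sum_weightedInner (fun _ : Fin N => IsBddWeight.const 1) G G
  have i2 := (integrable_sum_weightedInner hbr (fun _ => u) G).const_mul (2 * lam)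
  have i3 := (integrable_weightedInner hbq u u).const_mul lam
  have i12 : Integrable fun x => ∑ k, (1 : ℝ) * inner ℝ (G k x) (G k x) -
      2 * lam * ∑ k, μ₁ x * x k * inner ℝ (u x) (G k x) := i1.sub i2
  have hsq : ∀ x : 𝔼, (∑ k, (1 : ℝ) * inner ℝ (G k x) (G k x) -
      2 * lam * ∑ k, μ₁ x * x k * inner ℝ (u x) (G k x)) +
      lam * ((μ x - N * μ₁ x) * inner ℝ (u x) (u x)) =
      ∑ k, ‖G k x - (lam * μ₁ x * x k) • u x‖ ^ 2 +
        lam * ((μ x - N * μ₁ x - lam * (‖x‖ * μ₁ x) ^ 2) * ‖u x‖ ^ 2) := by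
    intro x
    have e : ∀ k, ‖G k x - (lam * μ₁ x * x k) • u x‖ ^ 2 = 1 * inner ℝ (G k x) (G k x) -
        2 * lam * (μ₁ x * x k * inner ℝ (u x) (G k x)) +
        lam ^ 2 * μ₁ x ^ 2 * ‖u x‖ ^ 2 * x k ^ 2 := by
      intro k
      rw [norm_sub_sq_real, inner_smul_right, norm_smul, mul_pow, Real.norm_eq_abs, sq_abs,
        real_inner_comm, real_inner_self_eq_norm_sq]
      ring
    simp only [e, Finset.sum_add_distrib, Finset.sum_sub_distrib, ← Finset.mul_sum, sum_coord_sq,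
      real_inner_self_eq_norm_sq]
    ring
  have hnn : ∀ᵐ x, 0 ≤ lam * ((μ x - N * μ₁ x - lam * (‖x‖ * μ₁ x) ^ 2) * ‖u x‖ ^ 2) := by
    filter_upwards [hcond] with x hx
    have h2 : lam * (‖x‖ * μ₁ x) ^ 2 ≤ lam₀ * (‖x‖ * |μ₁ x|) ^ 2 := by
      rw [mul_pow, mul_pow, sq_abs]
      exact mul_le_mul_of_nonneg_right hle (by positivity)
    exact mul_nonneg hlam.le (mul_nonneg (by linarith) (sq_nonneg _))
  have hint : ∫ x, (∑ k, ‖G k x - (lam * μ₁ x * x k) • u x‖ ^ 2 +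
      lam * ((μ x - N * μ₁ x - lam * (‖x‖ * μ₁ x) ^ 2) * ‖u x‖ ^ 2)) ≤ 0 := by
    simp only [← hsq]
    rw [integral_add i12 i3, integral_sub i1 i2, integral_const_mul, integral_const_mul,
      ← sum_weightedInner (fun _ => IsBddWeight.const 1), ← sum_weightedInner hbr (fun _ => u),
      h.sum_normSq_gradient hW]
    change _ + lam * weightedInner (fun x => μ x - N * μ₁ x) u u ≤ 0
    rw [e1]
    rw [e0] at h1
    nlinarith
  have hI : Integrable fun x => ∑ k, ‖G k x - (lam * μ₁ x * x k) • u x‖ ^ 2 +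
      lam * ((μ x - N * μ₁ x - lam * (‖x‖ * μ₁ x) ^ 2) * ‖u x‖ ^ 2) := by
    simp only [← hsq]
    exact i12.add i3
  have hs0 : ∀ x, 0 ≤ ∑ k, ‖G k x - (lam * μ₁ x * x k) • u x‖ ^ 2 := fun x =>
    Finset.sum_nonneg fun k _ => sq_nonneg _
  have hnn' : 0 ≤ᵐ[volume] fun x => ∑ k, ‖G k x - (lam * μ₁ x * x k) • u x‖ ^ 2 +
      lam * ((μ x - N * μ₁ x - lam * (‖x‖ * μ₁ x) ^ 2) * ‖u x‖ ^ 2) := by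
    filter_upwards [hnn] with x hx
    exact add_nonneg (hs0 x) hx
  have hz := (integral_eq_zero_iff_of_nonneg_ae hnn' hI).1
    (le_antisymm hint (integral_nonneg_of_ae hnn'))
  refine h.eq_zero_of_gradient_eq hμ hN (μ₁ := μ₁) hW (fun k => ?_) ?_
  · filter_upwards [hz, hnn] with x h1 h2
    have h3 : ∑ k, ‖G k x - (lam * μ₁ x * x k) • u x‖ ^ 2 = 0 := by
      simp only [Pi.zero_apply] at h1
      linarith [hs0 x]
    rw [Finset.sum_eq_zero_iff_of_nonneg fun k _ => sq_nonneg _] at h3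
    simpa [sub_eq_zero] using h3 k (Finset.mem_univ k)
  · filter_upwards [hz, hnn] with x h1 h2
    have h3 : lam * ((μ x - N * μ₁ x - lam * (‖x‖ * μ₁ x) ^ 2) * ‖u x‖ ^ 2) = 0 := by
      simp only [Pi.zero_apply] at h1
      linarith [hs0 x]
    simpa [hlam.ne'] using h3

end Eigenfunctions

theorem IsLayeredMedium.isBddWeight {N : ℕ} (hN : 2 ≤ N) {L : Set ℤ}
    {Ω Sm Sp : ℤ → Set (EuclideanSpace ℝ (Fin N))} {ν : ℤ → ℝ}
    {μ₀ : EuclideanSpace ℝ (Fin N) → ℝ} (h : IsLayeredMedium L Ω Sm Sp ν μ₀)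
    (hm : AEMeasurable μ₀ volume) : IsBddWeight μ₀ := by
  obtain ⟨m, M, hm0, hb⟩ := h.bounds
  refine ⟨hm.aestronglyMeasurable, M, ?_⟩
  filter_upwards [ae_exists_mem hN h] with x ⟨ℓ, hℓ, hx⟩
  rw [abs_of_pos (h.pos x), h.value ℓ hℓ x hx]
  exact (hb ℓ hℓ).2

theorem theorem4p8 {N : ℕ} (hN : 2 ≤ N) (L : Set ℤ)
    (Ω Sm Sp : ℤ → Set (EuclideanSpace ℝ (Fin N))) (ν : ℤ → ℝ)
    (μ μ₀ μ₁ : EuclideanSpace ℝ (Fin N) → ℝ)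
    (hμ₀ : IsLayeredMedium L Ω Sm Sp ν μ₀)
    (hsum : ∀ x, μ x = μ₀ x + μ₁ x)
    (hμ : IsAdmissibleWeight μ) :
    (∀ lam₀ : ℝ, 0 < lam₀ →
      AEMeasurable μ₁ volume →
      (∀ᵐ x ∂volume, (N : ℝ) * μ₁ x + lam₀ * (‖x‖ * |μ₁ x|) ^ 2 ≤ μ x) →
      pointSpectrum (reducedWaveOperator hμ) ∩ (fun t : ℝ => (t : ℂ)) '' Set.Icc 0 lam₀ = ∅) ∧
    (Differentiable ℝ μ₁ →
      (∀ᵐ x ∂volume, 0 ≤ μ x + ‖x‖ * fderiv ℝ μ₁ x (‖x‖⁻¹ • x)) →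
      pointSpectrum (reducedWaveOperator hμ) = ∅) := by
  constructor
  · intro lam₀ _ hmeas hcond
    rw [eq_empty_iff_forall_notMem]
    rintro _ ⟨hz, lam, hlam, rfl⟩
    obtain ⟨u, W, G, hu, h, hW⟩ := exists_of_mem_pointSpectrum hμ hz
    refine hu ?_
    rcases hlam.1.eq_or_lt with rfl | hpos
    · exact h.eq_zero_of_eigenvalue_zero hN (by simpa using hW)
    · have hm : AEMeasurable μ₀ volume := by
        have e : μ₀ = fun x => μ x - μ₁ x := funext fun x => by rw [hsum]; ring
        rw [e]
        exact hμ.aemeasurable.sub hmeas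
      exact h.eq_zero_of_monotone hμ hN (hμ₀.isBddWeight hN hm) hsum
        (fun s hs => hμ₀.ae_le_smul hN hs) hpos hlam.2 hcond hW
  · intro hd hr
    rw [eq_empty_iff_forall_notMem]
    intro z hz
    obtain ⟨u, W, G, hu, h, hW⟩ := exists_of_mem_pointSpectrum hμ hz
    have him := h.im_eq_zero hμ hu hW
    obtain ⟨lam, rfl⟩ : ∃ lam : ℝ, (lam : ℂ) = z := ⟨z.re, Complex.ext rfl (by simp [him])⟩
    refine hu ?_
    -- `∫ |∇u|² = lam ∫ μ |u|²` excludes negative eigenvalues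
    have hnonneg : 0 ≤ lam := by
      by_contra! hneg
      obtain ⟨m, M, hm, hb⟩ := hμ.bounds
      refine hu (eq_zero_of_weightedInner_self_le hμ.isBddWeight
        (Eventually.of_forall fun x => hm.trans_le (hb x).1) ?_)
      have h1 := h.sum_normSq_gradient hW
      have h2 : 0 ≤ ∑ j, weightedInner (fun _ => 1) (G j) (G j) := Finset.sum_nonneg fun j _ =>
        weightedInner_self_nonneg (Eventually.of_forall fun _ => zero_le_one) _
      rw [h1] at h2
      by_contra! h3
      linarith [mul_neg_of_neg_of_pos hneg h3]
    rcases hnonneg.eq_or_lt with rfl | hpos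
    · exact h.eq_zero_of_eigenvalue_zero hN (by simpa using hW)
    · exact h.eq_zero_of_monotone_mul hμ hN (fun s hs => hμ₀.ae_le_mul_smul hN hsum hd hr hs)
        hpos hW
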